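/- **Decoupled bandit.** There are $K\ge 1$ arms. In each round $t=1,2,\dots$ an environment chooses a loss vector $\ell_t\in[0,1]^K$ and the learner chooses an exploited arm $i_t$ and an explored arm $j_t$; the learner suffers $\ell_{t,i_t}$ without observing it, and observes $\ell_{t,j_t}$ without suffering it. In the adversarial regime the environment may be randomized and adaptive: the law of $\ell_t$ may depend on all losses and arms of the rounds before $t$, and given these, $\ell_t$ is independent of $(i_t,j_t)$. A policy chooses the (joint) law of $(i_t,j_t)$ as a function of $(i_s,j_s,\ell_{s,j_s})_{s<t}$. The pseudo-regret is $$\mathrm{Reg}(T)=\mathbb E\Big[\sum_{t=1}^T\ell_{t,i_t}\Big]-\min_{i\in[K]}\mathbb E\Big[\sum_{t=1}^T\ell_{t,i}\Big].$$ **Algorithm 1 (FTPL for decoupled bandits)** with shape $\alpha>1$ and learning rates $\eta_t>0$. Put $\hat L_1=0\in\mathbb R^K$. In round $t$: draw $r_{t,1},\dots,r_{t,K}$ i.i.d. from the Pareto distribution with density $\alpha x^{-\alpha-1}$ on $[1,\infty)$ and exploit $i_t=\arg\min_{i}\{\hat L_{t,i}-r_{t,i}/\eta_t\}$; independently, explore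 $j_t\sim p_t$, where $$p_{t,i}=\frac{q_{t,i}}{\sum_{j}q_{t,j}},\qquad q_{t,i}=\min\Big\{\frac1{1+\eta_t(\hat L_{t,i}-\min_j\hat L_{t,j})},\ \frac1{\sigma_{t,i}^{1/\alpha}}\Big\}^{\frac{\alpha+1}2},$$ and $\sigma_{t,i}\in\{1,\dots,K\}$ is the rank of $\hat L_{t,i}$ among $\hat L_{t,1},\dots,\hat L_{t,K}$ in increasing order, ties being broken by an arbitrary (measurable) rule; then put $\hat L_{t+1}=\hat L_t+\ell_{t,j_t}p_{t,j_t}^{-1}e_{j_t}$. **Theorem 1.** (i) For all $\alpha>1$ and $c>0$ there is a constant $C$, depending only on $\alpha$ and $c$, such that for every $K\ge1$, every $T$, every tie-breaking rule for the ranks and every (adaptive) environment, Algorithm 1 with $\eta_t=cK^{1/\alpha-1/2}/\sqrt t$ satisfies $\mathrm{Reg}(T)\le C\sqrt{KT}$. (ii) This rate is minimax optimal: there is a universal constant $c_0>0$ such that for all $K\ge2$, $T\ge K$ and every policy there is an environment (which may be taken with i.i.d. loss vectors) in which that policy has $\mathrm{Reg}(T)\ge c_0\sqrt{KT}$. -/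

import Mathlib

open MeasureTheory ProbabilityTheory

noncomputable section

namespace DecoupledBandit

/-- The set of possible values of a loss, `[0, 1]`. -/
abbrev Loss : Type := Set.Icc (0 : ℝ) 1

/-- What happens in one round: the loss vector `ℓ`, the exploited arm `i`, the explored arm `j`. -/
abbrev Round (K : ℕ) : Type := (Fin K → Loss) × (Fin K × Fin K)

/-- What the learner knows about one round: the exploited arm `i`, the explored arm `j` and the
loss of the explored arm. -/
abbrev Obs (K : ℕ) : Type := (Fin K × Fin K) × Loss

/-- The part of a history of `t` rounds that is visible to the learner. -/
def observe {K t : ℕ} (h : Fin t → Round K) : Fin t → Obs K :=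
  fun s => ((h s).2, (h s).1 (h s).2.2)

/-- A (possibly adaptive) environment: the conditional law of the loss vector of the round after
the first `t` rounds, given everything that happened in these rounds. -/
structure Environment (K : ℕ) where
  kernel : (t : ℕ) → Kernel (Fin t → Round K) (Fin K → Loss)
  isMarkov : ∀ t, IsMarkovKernel (kernel t)

/-- The (oblivious) environment whose loss vectors are i.i.d. with law `ν`. -/
def Environment.iid {K : ℕ} (ν : ProbabilityMeasure (Fin K → Loss)) : Environment K where
  kernel _ := Kernel.const _ (ν : Measure (Fin K → Loss))
  isMarkov _ := inferInstance

/-- A decoupled policy: the conditional law of the pair (exploited arm, explored arm) of the round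
after the first `t` rounds, given what the learner observed in these rounds. -/
structure Policy (K : ℕ) where
  kernel : (t : ℕ) → Kernel (Fin t → Obs K) (Fin K × Fin K)
  isMarkov : ∀ t, IsMarkovKernel (kernel t)

attribute [instance] Environment.isMarkov Policy.isMarkov

theorem measurable_observe {K t : ℕ} : Measurable (observe (K := K) (t := t)) := by
  refine measurable_pi_lambda _ fun s => ?_
  have h1 : Measurable fun x : Round K => (x.2, x.1 x.2.2) := by
    refine measurable_snd.prodMk ?_
    have : Measurable fun y : (Fin K → Loss) × Fin K => y.1 y.2 :=
      measurable_from_prod_countable_left fun j => measurable_pi_apply j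
    exact this.comp (measurable_fst.prodMk (measurable_snd.comp measurable_snd))
  exact h1.comp (measurable_pi_apply s)

/-- The conditional law of a round given the past: given the past, the loss vector and the two arms
are independent. -/
def roundKernel {K : ℕ} (π : Policy K) (env : Environment K) (t : ℕ) :
    Kernel (Fin t → Round K) (Round K) :=
  env.kernel t ×ₖ (π.kernel t).comap observe measurable_observe

/-- The joint law of the first `t` rounds. -/
def historyMeasure {K : ℕ} (π : Policy K) (env : Environment K) :
    (t : ℕ) → Measure (Fin t → Round K)
  | 0 => Measure.dirac Fin.elim0
  | t + 1 => (historyMeasure π env t ⊗ₘ roundKernel π env t).map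
      fun x => Fin.snoc (α := fun _ => Round K) x.1 x.2

/-- The pseudo-regret
`𝔼[∑ ℓ_{t, i_t}] - min_i 𝔼[∑ ℓ_{t, i}]` of the policy `π` after `T` rounds. -/
def pseudoRegret {K : ℕ} (π : Policy K) (env : Environment K) (T : ℕ) : ℝ :=
  (∫ h, ∑ s, ((h s).1 (h s).2.1 : ℝ) ∂historyMeasure π env T) -
    ⨅ i : Fin K, ∫ h, ∑ s, ((h s).1 i : ℝ) ∂historyMeasure π env T

/-- A way to rank the entries of a vector `L` in increasing order. Ties are broken arbitrarily,
possibly depending on the round and on the observed history. Ranks are counted from `0` here. -/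
structure RankRule (K : ℕ) where
  rank : (t : ℕ) → (Fin t → Obs K) → (Fin K → ℝ) → Equiv.Perm (Fin K)
  sorted : ∀ t h L i j, rank t h L i < rank t h L j → L i ≤ L j
  measurable : ∀ t i, Measurable fun x : (Fin t → Obs K) × (Fin K → ℝ) => rank t x.1 x.2 i

section Algorithm

variable {K : ℕ}

/-- The loss-gap vector `L - 𝟏 min_j L_j`. -/
def gap (L : Fin K → ℝ) (i : Fin K) : ℝ := L i - ⨅ j, L j

/-- The unnormalised exploration weights `q_i`, for the ranks `σ_i = ρ i + 1 ∈ {1, …, K}`. -/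
def exploreWeight (α η : ℝ) (L : Fin K → ℝ) (ρ : Equiv.Perm (Fin K)) (i : Fin K) : ℝ :=
  (min (1 / (1 + η * gap L i)) (1 / (((ρ i : ℕ) : ℝ) + 1) ^ (1 / α))) ^ ((α + 1) / 2)

/-- The exploration probabilities `p_i = q_i / ∑_j q_j`. -/
def exploreProb (α η : ℝ) (L : Fin K → ℝ) (ρ : Equiv.Perm (Fin K)) (i : Fin K) : ℝ :=
  exploreWeight α η L ρ i / ∑ j, exploreWeight α η L ρ j

/-- The importance-weighted estimate of the cumulative loss vector after `t` rounds. Rounds are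
counted from `0`: the learning rate of the round that follows `t` completed rounds is `η t`. -/
def lossEst (α : ℝ) (η : ℕ → ℝ) (R : RankRule K) : (t : ℕ) → (Fin t → Obs K) → Fin K → ℝ
  | 0, _ => 0
  | t + 1, h =>
    let L := lossEst α η R t (Fin.init h)
    let j := (h (Fin.last t)).1.2
    let p := exploreProb α (η t) L (R.rank t (Fin.init h) L)
    L + Pi.single j (((h (Fin.last t)).2 : ℝ) / p j)

/-- A minimiser of `v` (the one with the smallest index). -/
def argmin [NeZero K] (v : Fin K → ℝ) : Fin K :=
  {i : Fin K | ∀ j, v i ≤ v j}.toFinset.min' (by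
    obtain ⟨i, hi⟩ := Finite.exists_min v
    exact ⟨i, by simpa using hi⟩)

theorem argmin_le [NeZero K] (v : Fin K → ℝ) (j : Fin K) : v (argmin v) ≤ v j := by
  have := Finset.min'_mem {i : Fin K | ∀ j, v i ≤ v j}.toFinset (by
    obtain ⟨i, hi⟩ := Finite.exists_min v
    exact ⟨i, by simpa using hi⟩)
  simp only [Set.mem_toFinset, Set.mem_ofPred_eq] at this
  exact this j

theorem measurable_argmin [NeZero K] : Measurable (argmin (K := K)) := by
  refine measurable_to_countable' fun i => ?_
  have : argmin (K := K) ⁻¹' {i} =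
      {v | (∀ j, v i ≤ v j) ∧ ∀ k, (∀ j, v k ≤ v j) → i ≤ k} := by
    ext v
    constructor
    · rintro rfl
      exact ⟨argmin_le v, fun k hk => Finset.min'_le _ _ (by simpa using hk)⟩
    · rintro ⟨h1, h2⟩
      refine le_antisymm (Finset.min'_le _ _ (by simpa using h1)) (h2 _ (argmin_le v))
  rw [this]
  measurability

theorem measurable_gap (i : Fin K) : Measurable fun L : Fin K → ℝ => gap L i := by
  unfold gap
  exact (measurable_pi_apply i).sub (Measurable.iInf fun j => measurable_pi_apply j)

theorem measurable_exploreWeight (α η : ℝ) (R : RankRule K) (t : ℕ) (i : Fin K) :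
    Measurable fun x : (Fin t → Obs K) × (Fin K → ℝ) =>
      exploreWeight α η x.2 (R.rank t x.1 x.2) i := by
  unfold exploreWeight
  have h1 : Measurable fun x : (Fin t → Obs K) × (Fin K → ℝ) => gap x.2 i :=
    (measurable_gap i).comp measurable_snd
  have h2 : Measurable fun x : (Fin t → Obs K) × (Fin K → ℝ) =>
      ((R.rank t x.1 x.2 i : ℕ) : ℝ) :=
    (measurable_of_countable (fun k : Fin K => ((k : ℕ) : ℝ))).comp (R.measurable t i)
  fun_prop

theorem measurable_exploreProb (α η : ℝ) (R : RankRule K) (t : ℕ) (i : Fin K) :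
    Measurable fun x : (Fin t → Obs K) × (Fin K → ℝ) =>
      exploreProb α η x.2 (R.rank t x.1 x.2) i := by
  unfold exploreProb
  exact (measurable_exploreWeight α η R t i).div
    (Finset.measurable_sum _ fun j _ => measurable_exploreWeight α η R t j)

theorem measurable_lossEst (α : ℝ) (η : ℕ → ℝ) (R : RankRule K) (t : ℕ) :
    Measurable (lossEst α η R t) := by
  induction t with
  | zero => exact measurable_const
  | succ t ih =>
    have hi : Measurable fun h : Fin (t + 1) → Obs K => (Fin.init h : Fin t → Obs K) :=
      measurable_pi_lambda _ fun s => measurable_pi_apply s.castSucc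
    have hL := ih.comp hi
    refine measurable_pi_lambda _ fun i => ?_
    have hp := (measurable_exploreProb α (η t) R t i).comp (hi.prodMk hL)
    have hl : Measurable fun h : Fin (t + 1) → Obs K => h (Fin.last t) := measurable_pi_apply _
    have heq : (fun h : Fin (t + 1) → Obs K => lossEst α η R (t + 1) h i) = fun h =>
        lossEst α η R t (Fin.init h) i + if (h (Fin.last t)).1.2 = i then
          ((h (Fin.last t)).2 : ℝ) / exploreProb α (η t) (lossEst α η R t (Fin.init h))
            (R.rank t (Fin.init h) (lossEst α η R t (Fin.init h))) i else 0 := by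
      funext h
      simp only [lossEst, Pi.add_apply, Pi.single_apply]
      by_cases hj : i = (h (Fin.last t)).1.2
      · subst hj; simp
      · simp [hj, Ne.symm hj]
    rw [heq]
    refine ((measurable_pi_apply i).comp hL).add (Measurable.ite ?_ ?_ measurable_const)
    · exact (measurable_snd.comp (measurable_fst.comp hl)) (measurableSet_singleton i)
    · exact (measurable_subtype_coe.comp (measurable_snd.comp hl)).div hp

/-- The exploited arm that results from the perturbations `r`. -/
def exploitArm [NeZero K] (α : ℝ) (η : ℕ → ℝ) (R : RankRule K) (t : ℕ)
    (x : (Fin t → Obs K) × (Fin K → ℝ)) : Fin K :=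
  argmin fun i => lossEst α η R t x.1 i - x.2 i / η t

theorem measurable_exploitArm [NeZero K] (α : ℝ) (η : ℕ → ℝ) (R : RankRule K) (t : ℕ) :
    Measurable (exploitArm α η R t) := by
  refine measurable_argmin.comp (measurable_pi_lambda _ fun i => ?_)
  exact ((measurable_pi_apply i).comp ((measurable_lossEst α η R t).comp measurable_fst)).sub
    (((measurable_pi_apply i).comp measurable_snd).div_const _)

/-- The conditional law of the exploited arm: draw i.i.d. Pareto perturbations (of scale `1` and
shape `α`) and follow the perturbed leader. -/
def exploitKernel [NeZero K] (α : ℝ) (η : ℕ → ℝ) (R : RankRule K) (t : ℕ) :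
    Kernel (Fin t → Obs K) (Fin K) :=
  (Kernel.id ×ₖ Kernel.const _ (Measure.pi fun _ : Fin K => paretoMeasure 1 α)).map
    (exploitArm α η R t)

/-- The exploration probabilities of the round that follows the observed history `h`. -/
def exploreDist (α : ℝ) (η : ℕ → ℝ) (R : RankRule K) (t : ℕ) (h : Fin t → Obs K) (i : Fin K) : ℝ :=
  exploreProb α (η t) (lossEst α η R t h) (R.rank t h (lossEst α η R t h)) i

theorem measurable_exploreDist (α : ℝ) (η : ℕ → ℝ) (R : RankRule K) (t : ℕ) (i : Fin K) :
    Measurable (fun h : Fin t → Obs K => exploreDist α η R t h i) := by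
  have h1 : Measurable fun h : Fin t → Obs K => (h, lossEst α η R t h) :=
    measurable_id.prodMk (measurable_lossEst α η R t)
  have h2 := (measurable_exploreProb α (η t) R t i).comp h1
  unfold exploreDist
  exact h2

/-- The conditional law of the explored arm. -/
def exploreKernel (α : ℝ) (η : ℕ → ℝ) (R : RankRule K) (t : ℕ) :
    Kernel (Fin t → Obs K) (Fin K) where
  toFun h := ∑ i, ENNReal.ofReal (exploreDist α η R t h i) • Measure.dirac i
  measurable' := by
    refine Measure.measurable_of_measurable_coe _ fun s _ => ?_
    simp only [Measure.coe_finsetSum, Finset.sum_apply, Measure.smul_apply, smul_eq_mul]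
    exact Finset.measurable_sum _ fun i _ =>
      (measurable_exploreDist α η R t i).ennreal_ofReal.mul_const _

theorem exploreWeight_pos {α η : ℝ} (hη : 0 < η) (L : Fin K → ℝ) (ρ : Equiv.Perm (Fin K))
    (i : Fin K) : 0 < exploreWeight α η L ρ i := by
  have hg : 0 ≤ gap L i := sub_nonneg.2 (ciInf_le (Set.finite_range L).bddBelow i)
  unfold exploreWeight
  positivity

theorem isMarkov_exploreKernel [NeZero K] {α : ℝ} {η : ℕ → ℝ} (hη : ∀ t, 0 < η t)
    (R : RankRule K) (t : ℕ) : IsMarkovKernel (exploreKernel α η R t) := by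
  refine ⟨fun h => ⟨?_⟩⟩
  have hw := fun i => exploreWeight_pos (α := α) (hη t) (lossEst α η R t h)
    (R.rank t h (lossEst α η R t h)) i
  have hs := Finset.sum_pos (fun i _ => hw i) (Finset.univ_nonempty (α := Fin K))
  have h0 : exploreKernel α η R t h Set.univ =
      ∑ i, ENNReal.ofReal (exploreDist α η R t h i) := by
    simp [exploreKernel]
  simp only [exploreDist, exploreProb] at h0
  rw [h0, ← ENNReal.ofReal_sum_of_nonneg (fun i _ => (div_pos (hw i) hs).le)]
  rw [← Finset.sum_div, div_self hs.ne', ENNReal.ofReal_one]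

theorem isMarkov_exploitKernel [NeZero K] {α : ℝ} (hα : 1 < α) (η : ℕ → ℝ)
    (R : RankRule K) (t : ℕ) : IsMarkovKernel (exploitKernel α η R t) := by
  have : IsProbabilityMeasure (paretoMeasure 1 α) :=
    isProbabilityMeasure_paretoMeasure one_pos (by linarith)
  unfold exploitKernel
  exact Kernel.IsMarkovKernel.map _ (measurable_exploitArm α η R t)

/-- Follow-the-perturbed-leader for decoupled exploration and exploitation: given the observed
history, the exploited arm and the explored arm are drawn independently. -/
def ftpl [NeZero K] (α : ℝ) (hα : 1 < α) (η : ℕ → ℝ) (hη : ∀ t, 0 < η t) (R : RankRule K) :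
    Policy K where
  kernel t := exploitKernel α η R t ×ₖ exploreKernel α η R t
  isMarkov t := by
    have := isMarkov_exploitKernel hα η R t
    have := isMarkov_exploreKernel (α := α) hη R t
    infer_instance

end Algorithm

/-- The learning rate `c K^{1/α - 1/2} / √(t + 1)`, where `t` is the number of completed rounds. -/
def learningRate (α c : ℝ) (K t : ℕ) : ℝ :=
  c * (K : ℝ) ^ (1 / α - 1 / 2) / √((t : ℝ) + 1)

theorem learningRate_pos (α : ℝ) {c : ℝ} (hc : 0 < c) (K : ℕ) [NeZero K] (t : ℕ) :
    0 < learningRate α c K t := by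
  have : 0 < K := Nat.pos_of_neZero K
  unfold learningRate
  positivity

end DecoupledBandit

end

namespace DecoupledBandit

/-! Upper bound. Put b = 1/η and let Φ_b(L) = E min_i (L_i - b r_i) be the `potential`. Its slope in
direction j is the probability that arm j leads, so by concavity raising L_j by x raises Φ_b by at
least x times the probability that j leads afterwards. The algorithm plays the probability before
the raise; the two differ by at most the probability that j is `overtaken`. Given the other
perturbations, overtaking confines r_j to a window of length x/b, where the Pareto density is small
for two reasons: r_j must compensate the loss gap, and it must beat the perturbations of all arms of
smaller rank. Together they bound the probability by 3α (x/b) q_j² (`measureReal_overtaken_le`).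

With x = ℓ_j/p_j and p_j = q_j/Q, Q being the sum of the weights q_j, these errors add up to at most
3αη Q², and the rank part of q gives Q² = O(K^(1-1/α)) (`sum_exploreWeight_sq_le`). Because
exploration is decoupled, p may be matched to the stability term in this way. Increasing b costs its
increment times the expected largest perturbation, O(K^(1/α)), and this telescopes. Finally Φ_b(L) ≤
L_i, and the loss estimates are unbiased. For the prescribed rate both costs are O(√(KT))
(`integral_exploitLoss_le`, `pseudoRegret_ftpl_le`).

Lower bound. Compare fair coins for all arms with the environment in which a single arm a has mean
1/2 - ε, ε of order √(K/T). The observations separate the two only through explorations of a, and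
these number T/K on average over a, exploration being limited to one arm per round. The divergence
is then bounded, so for some a the policy exploits a in at most 3T/4 rounds on average and loses ε
in the others (`integral_bernoulli_le_integral_fair`, `exists_le_pseudoRegret`). -/

open scoped ENNReal

/-! ### The Pareto distribution: density, tails, truncated mean. -/

/-- The Pareto density with scale `1` is bounded by its value at any point to the left. -/
theorem paretoMeasure_Icc_le {α : ℝ} (hα : 0 < α) {x c δ : ℝ} (hx : 1 ≤ x)
    (hxc : x ≤ max 1 c) :
    paretoMeasure 1 α (Set.Icc c (c + δ)) ≤ ENNReal.ofReal (α * x ^ (-(α + 1)) * δ) := by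
  have h0 : 0 ≤ α * x ^ (-(α + 1)) := by positivity
  rw [paretoMeasure, withDensity_apply _ measurableSet_Icc, ENNReal.ofReal_mul h0]
  calc ∫⁻ y in Set.Icc c (c + δ), paretoPDF 1 α y
      ≤ ∫⁻ _ in Set.Icc c (c + δ), ENNReal.ofReal (α * x ^ (-(α + 1))) := by
        refine setLIntegral_mono measurable_const fun y hy => ?_
        -- The density vanishes below `1`, so `x ≤ max 1 c` suffices in place of `x ≤ c`.
        rcases lt_or_ge y 1 with h | h
        · simp [paretoPDF_of_lt h]
        · rw [paretoPDF_of_le h, Real.one_rpow, mul_one]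
          refine ENNReal.ofReal_le_ofReal (mul_le_mul_of_nonneg_left ?_ hα.le)
          exact Real.rpow_le_rpow_of_nonpos (by linarith) (hxc.trans (max_le h hy.1)) (by linarith)
    _ = _ := by simp

theorem paretoMeasure_Ici {α : ℝ} (hα : 0 < α) {x : ℝ} (hx : 1 ≤ x) :
    paretoMeasure 1 α (Set.Ici x) = ENNReal.ofReal (x ^ (-α)) := by
  have hx0 : 0 < x := by linarith
  rw [paretoMeasure, withDensity_apply _ measurableSet_Ici]
  have h1 : ∫⁻ y in Set.Ici x, paretoPDF 1 α y
      = ∫⁻ y in Set.Ioi x, ENNReal.ofReal (α * y ^ (-(α + 1))) := by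
    rw [setLIntegral_congr (Ioi_ae_eq_Ici (μ := volume) (a := x)).symm]
    refine setLIntegral_congr_fun measurableSet_Ioi fun y hy => ?_
    rw [paretoPDF_of_le (hx.trans (Set.mem_Ioi.1 hy).le), Real.one_rpow, mul_one]
  rw [h1, ← ofReal_integral_eq_lintegral_ofReal, integral_const_mul,
    integral_Ioi_rpow_of_lt (by linarith) hx0]
  · congr 1
    have : -(α + 1) + 1 = -α := by ring
    rw [this]; field_simp
  · exact (integrableOn_Ioi_rpow_of_lt (by linarith) hx0).const_mul α
  · rw [Filter.EventuallyLE, ae_restrict_iff' measurableSet_Ioi]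
    filter_upwards with y hy
    have : 0 < y := hx0.trans hy
    simp only [Pi.zero_apply]; positivity

theorem paretoMeasure_Iio {α : ℝ} (hα : 0 < α) {x : ℝ} (hx : 1 ≤ x) :
    paretoMeasure 1 α (Set.Iio x) = ENNReal.ofReal (1 - x ^ (-α)) := by
  have := isProbabilityMeasure_paretoMeasure one_pos hα
  have h0 : 0 < x := by linarith
  rw [← Set.compl_Ici, prob_compl_eq_one_sub measurableSet_Ici, paretoMeasure_Ici hα hx,
    ENNReal.ofReal_sub _ (by positivity), ENNReal.ofReal_one]

theorem ae_one_le_paretoMeasure {α : ℝ} (hα : 0 < α) : ∀ᵐ x ∂paretoMeasure 1 α, 1 ≤ x := by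
  rw [ae_iff]
  have := paretoMeasure_Iio hα le_rfl
  simpa [Set.Iio_def] using this

/-- Level `1` yields integrability of a perturbation; level `K ^ (1 / α)` controls the largest of
`K` of them. -/
theorem lintegral_indicator_Ici_paretoMeasure {α : ℝ} (hα : 1 < α) {a : ℝ} (ha : 1 ≤ a) :
    ∫⁻ x, ENNReal.ofReal ((Set.Ici a).indicator id x) ∂paretoMeasure 1 α
      = ENNReal.ofReal (α / (α - 1) * a ^ (1 - α)) := by
  have ha0 : 0 < a := by linarith
  rw [paretoMeasure, lintegral_withDensity_eq_lintegral_mul _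
    (show Measurable (paretoPDF 1 α) from (measurable_paretoPDFReal 1 α).ennreal_ofReal)
    ((measurable_id.indicator measurableSet_Ici).ennreal_ofReal)]
  have h1 : ∫⁻ y, (paretoPDF 1 α * fun x => ENNReal.ofReal ((Set.Ici a).indicator id x)) y
      = ∫⁻ y in Set.Ioi a, ENNReal.ofReal (α * y ^ (-α)) := by
    rw [setLIntegral_congr (Ioi_ae_eq_Ici (μ := volume) (a := a)),
      ← lintegral_indicator measurableSet_Ici]
    refine lintegral_congr fun y => ?_
    by_cases hy : a ≤ y
    · have hy0 : 0 < y := ha0.trans_le hy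
      simp only [Pi.mul_apply, Set.mem_Ici, hy, Set.indicator_of_mem, id]
      rw [paretoPDF_of_le (ha.trans hy), Real.one_rpow, mul_one, ← ENNReal.ofReal_mul
        (by positivity), mul_assoc, ← Real.rpow_add_one hy0.ne']
      congr 3; ring
    · simp [hy]
  rw [h1, ← ofReal_integral_eq_lintegral_ofReal, integral_const_mul,
    integral_Ioi_rpow_of_lt (by linarith) ha0]
  · congr 1
    have h2 : -α + 1 = 1 - α := by ring
    have h3 : α - 1 ≠ 0 := by linarith
    have h4 : 1 - α ≠ 0 := by linarith
    rw [h2]; field_simp; ring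
  · exact (integrableOn_Ioi_rpow_of_lt (by linarith) ha0).const_mul α
  · rw [Filter.EventuallyLE, ae_restrict_iff' measurableSet_Ioi]
    filter_upwards with y hy
    have : 0 < y := ha0.trans hy
    simp only [Pi.zero_apply]; positivity

theorem integrable_indicator_Ici_paretoMeasure {α : ℝ} (hα : 1 < α) {a : ℝ} (ha : 1 ≤ a) :
    Integrable ((Set.Ici a).indicator id) (paretoMeasure 1 α) := by
  refine ⟨(measurable_id.indicator measurableSet_Ici).aestronglyMeasurable, ?_⟩
  rw [hasFiniteIntegral_iff_ofReal, lintegral_indicator_Ici_paretoMeasure hα ha]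
  · exact ENNReal.ofReal_lt_top
  · exact Filter.Eventually.of_forall fun x => Set.indicator_nonneg
      (fun y hy => zero_le_one.trans (ha.trans hy)) x

theorem integral_indicator_Ici_paretoMeasure {α : ℝ} (hα : 1 < α) {a : ℝ} (ha : 1 ≤ a) :
    ∫ x, (Set.Ici a).indicator id x ∂paretoMeasure 1 α = α / (α - 1) * a ^ (1 - α) := by
  have ha0 : 0 < a := by linarith
  rw [integral_eq_lintegral_of_nonneg_ae, lintegral_indicator_Ici_paretoMeasure hα ha,
    ENNReal.toReal_ofReal]
  · have : 0 < α - 1 := by linarith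
    positivity
  · exact Filter.Eventually.of_forall fun x => Set.indicator_nonneg
      (fun y hy => zero_le_one.trans (ha.trans hy)) x
  · exact (measurable_id.indicator measurableSet_Ici).aestronglyMeasurable

theorem integrable_id_paretoMeasure {α : ℝ} (hα : 1 < α) :
    Integrable (fun x : ℝ => x) (paretoMeasure 1 α) := by
  refine (integrable_indicator_Ici_paretoMeasure hα le_rfl).congr ?_
  filter_upwards [ae_one_le_paretoMeasure (by linarith : 0 < α)] with x hx
  simp [hx]

/-! ### Independent perturbations and their maximum. -/

/-- The law of `K` i.i.d. Pareto perturbations. -/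
noncomputable abbrev pertMeasure (α : ℝ) (K : ℕ) : Measure (Fin K → ℝ) :=
  Measure.pi fun _ : Fin K => paretoMeasure 1 α

theorem isProbabilityMeasure_pertMeasure {α : ℝ} (hα : 0 < α) (K : ℕ) :
    IsProbabilityMeasure (pertMeasure α K) := by
  have := isProbabilityMeasure_paretoMeasure one_pos hα
  infer_instance

theorem ae_one_le_pertMeasure {α : ℝ} (hα : 0 < α) (K : ℕ) :
    ∀ᵐ r ∂pertMeasure α K, ∀ k, 1 ≤ r k := by
  have := isProbabilityMeasure_paretoMeasure one_pos hα
  rw [ae_all_iff]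
  intro k
  exact (measurePreserving_eval (fun _ : Fin K => paretoMeasure 1 α) k).quasiMeasurePreserving.ae
    (ae_one_le_paretoMeasure hα)

/-- Integrals of functions of one perturbation. -/
theorem integrable_comp_eval_pertMeasure {α : ℝ} (hα : 0 < α) {K : ℕ} (k : Fin K) {f : ℝ → ℝ}
    (hf : Integrable f (paretoMeasure 1 α)) :
    Integrable (fun r : Fin K → ℝ => f (r k)) (pertMeasure α K) := by
  have := isProbabilityMeasure_paretoMeasure one_pos hα
  exact (measurePreserving_eval (fun _ : Fin K => paretoMeasure 1 α) k).integrable_comp_of_integrable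
    hf

theorem integral_comp_eval_pertMeasure {α : ℝ} (hα : 0 < α) {K : ℕ} (k : Fin K) {f : ℝ → ℝ}
    (hf : Integrable f (paretoMeasure 1 α)) :
    ∫ r : Fin K → ℝ, f (r k) ∂pertMeasure α K = ∫ x, f x ∂paretoMeasure 1 α := by
  have := isProbabilityMeasure_paretoMeasure one_pos hα
  have h := measurePreserving_eval (fun _ : Fin K => paretoMeasure 1 α) k
  conv_rhs => rw [← h.map_eq]
  rw [integral_map h.measurable.aemeasurable (by rw [h.map_eq]; exact hf.aestronglyMeasurable)]

/-- An integrable upper bound for all perturbations, of expectation `O(K ^ (1 / α))`. -/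
theorem exists_dominating_perturbation {α : ℝ} (hα : 1 < α) (K : ℕ) [NeZero K] :
    ∃ M : (Fin K → ℝ) → ℝ, Integrable M (pertMeasure α K) ∧ (∀ r i, r i ≤ M r) ∧
      ∫ r, M r ∂pertMeasure α K = (1 + α / (α - 1)) * (K : ℝ) ^ (1 / α) := by
  have hα0 : 0 < α := by linarith
  have := isProbabilityMeasure_pertMeasure hα0 K
  have hK : (1 : ℝ) ≤ K := by exact_mod_cast Nat.one_le_iff_ne_zero.2 (NeZero.ne K)
  have hK0 : (0 : ℝ) < K := by linarith
  -- The level that each perturbation exceeds with probability `1 / K`. The dominating variable is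
  -- `a` plus all perturbations above `a`; the latter have total mean `K * (α / (α - 1)) * a ^ (1 -
  -- α)`, a multiple of `a`.
  set a : ℝ := (K : ℝ) ^ (1 / α) with ha
  have ha1 : 1 ≤ a := Real.one_le_rpow hK (by positivity)
  have hn : ∀ x : ℝ, 0 ≤ (Set.Ici a).indicator id x := fun x => Set.indicator_nonneg
      (fun y hy => zero_le_one.trans (ha1.trans hy)) x
  have hi := integrable_indicator_Ici_paretoMeasure hα ha1
  have hi' := fun k : Fin K => integrable_comp_eval_pertMeasure hα0 k hi
  refine ⟨fun r => a + ∑ i, (Set.Ici a).indicator id (r i), ?_, fun r i => ?_, ?_⟩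
  · exact (integrable_const a).add (integrable_finsetSum _ fun k _ => hi' k)
  · have h1 := Finset.single_le_sum (f := fun i => (Set.Ici a).indicator id (r i))
      (fun i _ => hn (r i)) (Finset.mem_univ i)
    have h2 : r i ≤ a + (Set.Ici a).indicator id (r i) := by
      by_cases h : a ≤ r i
      · simp [h]; linarith
      · simp [h]; linarith
    linarith
  · rw [integral_add (integrable_const a) (integrable_finsetSum _ fun k _ => hi' k),
      integral_finsetSum _ fun k _ => hi' k]
    have h4 : ∀ k : Fin K, ∫ r, (Set.Ici a).indicator id (r k) ∂pertMeasure α K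
        = α / (α - 1) * a ^ (1 - α) := fun k =>
      (integral_comp_eval_pertMeasure hα0 k hi).trans (integral_indicator_Ici_paretoMeasure hα ha1)
    simp only [h4]
    have h3 : (K : ℝ) * a ^ (1 - α) = a := by
      rw [ha, ← Real.rpow_mul hK0.le]
      nth_rw 1 [← Real.rpow_one (K : ℝ)]
      rw [← Real.rpow_add hK0]
      congr 1; field_simp; ring
    simp only [integral_const, probReal_univ, smul_eq_mul, one_mul, Finset.sum_const,
      Finset.card_univ, Fintype.card_fin, nsmul_eq_mul]
    rw [mul_left_comm, h3]; ring

/-- The largest of the value `1` and the perturbations with index in `S`. -/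
noncomputable def maxOn {K : ℕ} (S : Finset (Fin K)) (r : Fin K → ℝ) : ℝ :=
  ⨆ k, if k ∈ S then r k else 1

theorem measurable_maxOn {K : ℕ} (S : Finset (Fin K)) : Measurable (maxOn S) := by
  unfold maxOn
  refine Measurable.iSup fun k => ?_
  by_cases h : k ∈ S
  · simpa [h] using measurable_pi_apply k
  · simp [h]

/-- An index outside `S` contributes the default value `1`, the left end of the Pareto support. This
covers the empty set `S` and makes the bound hold for every `r`, not only almost surely. -/
theorem one_le_maxOn {K : ℕ} {S : Finset (Fin K)} {j : Fin K} (hj : j ∉ S) (r : Fin K → ℝ) :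
    1 ≤ maxOn S r := by
  have := le_ciSup (Set.finite_range fun k => if k ∈ S then r k else 1).bddAbove j
  simpa [maxOn, hj] using this

theorem le_maxOn {K : ℕ} {S : Finset (Fin K)} {k : Fin K} (hk : k ∈ S) (r : Fin K → ℝ) :
    r k ≤ maxOn S r := by
  have := le_ciSup (Set.finite_range fun k => if k ∈ S then r k else 1).bddAbove k
  simpa [maxOn, hk] using this

theorem maxOn_eq {K : ℕ} (S : Finset (Fin K)) (j : Fin K) (r : Fin K → ℝ) :
    maxOn S r = 1 ∨ ∃ k ∈ S, maxOn S r = r k := by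
  have : Nonempty (Fin K) := ⟨j⟩
  obtain ⟨k, hk⟩ := exists_eq_ciSup_of_finite (f := fun k => if k ∈ S then r k else 1)
  by_cases h : k ∈ S
  · exact Or.inr ⟨k, h, by simpa [maxOn, h] using hk.symm⟩
  · exact Or.inl (by simpa [maxOn, h] using hk.symm)

theorem pertMeasure_maxOn_lt {α : ℝ} (hα : 0 < α) {K : ℕ} (S : Finset (Fin K)) {x : ℝ}
    (hx : 1 ≤ x) :
    pertMeasure α K {r | maxOn S r < x} ≤ ENNReal.ofReal (1 - x ^ (-α)) ^ S.card := by
  have := isProbabilityMeasure_paretoMeasure one_pos hα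
  calc pertMeasure α K {r | maxOn S r < x}
      ≤ pertMeasure α K (Set.univ.pi fun k => if k ∈ S then Set.Iio x else Set.univ) := by
        refine measure_mono fun r hr => ?_
        rw [Set.mem_univ_pi]
        intro k
        by_cases h : k ∈ S
        · simpa [h] using (le_maxOn h r).trans_lt hr
        · simp [h]
    _ = ∏ k, if k ∈ S then ENNReal.ofReal (1 - x ^ (-α)) else 1 := by
        rw [Measure.pi_pi]
        refine Finset.prod_congr rfl fun k _ => ?_
        by_cases h : k ∈ S
        · simp [h, paretoMeasure_Iio hα hx]
        · simp [h]
    _ = _ := by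
        rw [Finset.prod_ite_mem, Finset.univ_inter, Finset.prod_const]

theorem integral_mul_one_sub_pow (n : ℕ) :
    ∫ t in (0 : ℝ)..1, (1 - t) ^ n * t = 1 / ((n + 1) * (n + 2)) := by
  have hd : ∀ t ∈ Set.uIcc (0 : ℝ) 1, HasDerivAt
      (fun t : ℝ => (1 - t) ^ (n + 2) / (n + 2) - (1 - t) ^ (n + 1) / (n + 1))
      ((1 - t) ^ n * t) t := by
    intro t _
    have h1 : HasDerivAt (fun t : ℝ => 1 - t) (-1) t := by
      simpa using (hasDerivAt_id t).const_sub 1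
    have h2 := ((h1.pow (n + 2)).div_const ((n : ℝ) + 2)).sub
      ((h1.pow (n + 1)).div_const ((n : ℝ) + 1))
    have h3 : (n : ℝ) + 1 ≠ 0 := by positivity
    have h4 : (n : ℝ) + 2 ≠ 0 := by positivity
    refine HasDerivAt.congr_deriv (f := fun t : ℝ =>
      (1 - t) ^ (n + 2) / (n + 2) - (1 - t) ^ (n + 1) / (n + 1)) h2 ?_
    have e1 : n + 2 - 1 = n + 1 := rfl
    have e2 : n + 1 - 1 = n := rfl
    rw [e1, e2]
    push_cast
    field_simp
    ring
  rw [intervalIntegral.integral_eq_sub_of_hasDerivAt hd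
    (Continuous.intervalIntegrable (by fun_prop) _ _)]
  have h3 : (n : ℝ) + 1 ≠ 0 := by positivity
  have h4 : (n : ℝ) + 2 ≠ 0 := by positivity
  simp
  field_simp
  ring

/-- If `r` is Pareto then `r ^ (-α)` is uniform on `[0, 1]`, so `maxOn S r ^ (-α)` is distributed as
the minimum of `S.card` uniform variables. The layer-cake formula turns its second moment into a
Beta integral. -/
theorem lintegral_maxOn_sq_le {α : ℝ} (hα : 0 < α) {K : ℕ} {S : Finset (Fin K)} {j : Fin K}
    (hj : j ∉ S) :
    ∫⁻ r, ENNReal.ofReal ((maxOn S r ^ (-α)) ^ (2 : ℝ)) ∂pertMeasure α K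
      ≤ ENNReal.ofReal (2 / ((S.card : ℝ) + 1) ^ 2) := by
  have := isProbabilityMeasure_paretoMeasure one_pos hα
  have h1 := one_le_maxOn hj
  have hnn : ∀ r, 0 ≤ maxOn S r ^ (-α) := fun r =>
    Real.rpow_nonneg (zero_le_one.trans (h1 r)) _
  have hle : ∀ r, maxOn S r ^ (-α) ≤ 1 := fun r =>
    Real.rpow_le_one_of_one_le_of_nonpos (h1 r) (by linarith)
  rw [lintegral_rpow_eq_lintegral_meas_lt_mul _ (Filter.Eventually.of_forall hnn)
    ((measurable_maxOn S).pow_const _).aemeasurable two_pos]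
  have key : ∀ t ∈ Set.Ioi (0 : ℝ), pertMeasure α K {r | t < maxOn S r ^ (-α)} *
      ENNReal.ofReal (t ^ ((2 : ℝ) - 1)) ≤
      (Set.Ioc (0 : ℝ) 1).indicator (fun t => ENNReal.ofReal ((1 - t) ^ S.card * t)) t := by
    intro t ht
    have ht : 0 < t := ht
    by_cases ht1 : t ≤ 1
    · rw [Set.indicator_of_mem (Set.mem_Ioc.2 ⟨ht, ht1⟩), ENNReal.ofReal_mul (pow_nonneg (by linarith) _),
        ENNReal.ofReal_pow (by linarith)]
      have h2 : t ^ ((2 : ℝ) - 1) = t := by norm_num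
      rw [h2]
      gcongr
      have hx : 1 ≤ t ^ (-(1 / α)) := Real.one_le_rpow_of_pos_of_le_one_of_nonpos ht ht1
        (by have : 0 < 1 / α := by positivity
            linarith)
      have h3 : (t ^ (-(1 / α))) ^ (-α) = t := by
        rw [← Real.rpow_mul ht.le]
        have : -(1 / α) * -α = 1 := by field_simp
        rw [this, Real.rpow_one]
      refine (measure_mono fun r hr => ?_).trans ((pertMeasure_maxOn_lt hα S hx).trans_eq ?_)
      · have hr : t < maxOn S r ^ (-α) := hr
        by_contra hc
        have hc : t ^ (-(1 / α)) ≤ maxOn S r := not_lt.1 hc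
        have := Real.rpow_le_rpow_of_nonpos (by linarith) hc (by linarith : -α ≤ 0)
        rw [h3] at this
        linarith
      · rw [h3]
    · have : {r : Fin K → ℝ | t < maxOn S r ^ (-α)} = ∅ := by
        ext r
        simp only [Set.mem_ofPred_eq, Set.mem_empty_iff_false, iff_false, not_lt]
        exact (hle r).trans (not_le.1 ht1).le
      rw [this]
      simp
  have hI : ∫⁻ t in Set.Ioi (0 : ℝ), pertMeasure α K {r | t < maxOn S r ^ (-α)} *
      ENNReal.ofReal (t ^ ((2 : ℝ) - 1)) ≤
      ENNReal.ofReal (1 / (((S.card : ℝ) + 1) * ((S.card : ℝ) + 2))) := by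
    refine (setLIntegral_mono' measurableSet_Ioi key).trans ?_
    refine (setLIntegral_le_lintegral _ _).trans ?_
    rw [lintegral_indicator measurableSet_Ioc, ← ofReal_integral_eq_lintegral_ofReal,
      ← intervalIntegral.integral_of_le zero_le_one, integral_mul_one_sub_pow]
    · exact ((by fun_prop : Continuous fun t : ℝ => (1 - t) ^ S.card * t).integrableOn_Icc
        (a := 0) (b := 1)).mono_set Set.Ioc_subset_Icc_self
    · rw [Filter.EventuallyLE, ae_restrict_iff' measurableSet_Ioc]
      filter_upwards with y hy
      exact mul_nonneg (pow_nonneg (by linarith [hy.2]) _) hy.1.le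
  refine (mul_le_mul_right hI _).trans ?_
  rw [← ENNReal.ofReal_mul zero_le_two]
  refine ENNReal.ofReal_le_ofReal ?_
  rw [mul_one_div]
  gcongr
  nlinarith

/-- With `Y = maxOn S r ^ (-α)` the integrand is `Y ^ p`, `p = 1 + 1 / α`. As `Y` has order `1 / σ`
with `σ = S.card + 1`, this should be `O(σ ^ (-p))`; since `p ≤ 2`, the second moment of `σ * Y` is
enough to show it. -/
theorem lintegral_maxOn_rpow_le {α : ℝ} (hα : 1 < α) {K : ℕ} {S : Finset (Fin K)} {j : Fin K}
    (hj : j ∉ S) :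
    ∫⁻ r, ENNReal.ofReal (maxOn S r ^ (-(α + 1))) ∂pertMeasure α K
      ≤ ENNReal.ofReal (3 * (1 / ((S.card : ℝ) + 1) ^ (1 / α)) ^ (α + 1)) := by
  have hα0 : 0 < α := by linarith
  have hP := isProbabilityMeasure_pertMeasure hα0 K
  set σ : ℝ := (S.card : ℝ) + 1 with hσ
  have hσ0 : 0 < σ := by positivity
  set p : ℝ := 1 + 1 / α with hp
  have hp0 : 0 < p := by positivity
  have hp2 : p ≤ 2 := by
    have : 1 / α ≤ 1 := by rw [div_le_one hα0]; exact hα.le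
    linarith
  have h1 := one_le_maxOn hj
  have hb : (1 / σ ^ (1 / α)) ^ (α + 1) = σ ^ (-p) := by
    rw [one_div, ← Real.rpow_neg hσ0.le, ← Real.rpow_mul hσ0.le]
    congr 1; rw [hp]; field_simp
  have hpt : ∀ r, maxOn S r ^ (-(α + 1)) ≤
      σ ^ (-p) * (1 + σ ^ 2 * (maxOn S r ^ (-α)) ^ (2 : ℝ)) := by
    intro r
    have hX : 0 < maxOn S r := zero_lt_one.trans_le (h1 r)
    set Y := maxOn S r ^ (-α) with hY
    have hY0 : 0 < Y := by positivity
    have h2 : maxOn S r ^ (-(α + 1)) = Y ^ p := by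
      rw [hY, ← Real.rpow_mul hX.le]; congr 1; rw [hp]; field_simp
    have h3 : Y ^ p = σ ^ (-p) * (σ * Y) ^ p := by
      rw [Real.mul_rpow hσ0.le hY0.le, ← mul_assoc, ← Real.rpow_add hσ0]; simp
    have h4 : (σ * Y) ^ p ≤ 1 + (σ * Y) ^ (2 : ℝ) := by
      rcases le_total (σ * Y) 1 with h | h
      · have := Real.rpow_le_one (by positivity) h hp0.le
        have : 0 ≤ (σ * Y) ^ (2 : ℝ) := by positivity
        linarith
      · have := Real.rpow_le_rpow_of_exponent_le h hp2
        linarith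
    rw [h2, h3]
    refine mul_le_mul_of_nonneg_left (h4.trans_eq ?_) (by positivity)
    rw [Real.mul_rpow hσ0.le hY0.le]; norm_num
  calc ∫⁻ r, ENNReal.ofReal (maxOn S r ^ (-(α + 1))) ∂pertMeasure α K
      ≤ ∫⁻ r, ENNReal.ofReal (σ ^ (-p)) * (1 + ENNReal.ofReal (σ ^ 2) *
          ENNReal.ofReal ((maxOn S r ^ (-α)) ^ (2 : ℝ))) ∂pertMeasure α K := by
        refine lintegral_mono fun r => (ENNReal.ofReal_le_ofReal (hpt r)).trans_eq ?_
        have hX : 0 < maxOn S r := zero_lt_one.trans_le (h1 r)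
        rw [ENNReal.ofReal_mul (by positivity), ENNReal.ofReal_add zero_le_one (by positivity),
          ENNReal.ofReal_one, ENNReal.ofReal_mul (by positivity)]
    _ = ENNReal.ofReal (σ ^ (-p)) * (1 + ENNReal.ofReal (σ ^ 2) *
          ∫⁻ r, ENNReal.ofReal ((maxOn S r ^ (-α)) ^ (2 : ℝ)) ∂pertMeasure α K) := by
        rw [lintegral_const_mul' _ _ ENNReal.ofReal_ne_top, lintegral_add_left measurable_const,
          lintegral_const_mul' _ _ ENNReal.ofReal_ne_top]
        simp
    _ ≤ ENNReal.ofReal (σ ^ (-p)) * (1 + ENNReal.ofReal (σ ^ 2) * ENNReal.ofReal (2 / σ ^ 2)) := by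
        gcongr
        exact lintegral_maxOn_sq_le hα0 hj
    _ = _ := by
        rw [← ENNReal.ofReal_mul (by positivity), ← ENNReal.ofReal_one,
          ← ENNReal.ofReal_add zero_le_one (by positivity), ← ENNReal.ofReal_mul (by positivity),
          hb]
        congr 1
        field_simp
        norm_num

/-! ### Stability: the probability of being overtaken. -/

/-- Integrating out one coordinate of a product of probability measures. -/
theorem lintegral_pi_eq_lintegral_update {K : ℕ} (μ : Measure ℝ) [IsProbabilityMeasure μ]
    (j : Fin K) {f : (Fin K → ℝ) → ℝ≥0∞} (hf : Measurable f) :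
    ∫⁻ r, f r ∂Measure.pi (fun _ : Fin K => μ)
      = ∫⁻ r, ∫⁻ y, f (Function.update r j y) ∂μ ∂Measure.pi (fun _ : Fin K => μ) := by
  have h := lmarginal_singleton (μ := fun _ : Fin K => μ) f j
  have hm : Measurable fun x : Fin K → ℝ => ∫⁻ y, f (Function.update x j y) ∂μ := by
    rw [← h]; exact hf.lmarginal _
  refine lintegral_eq_of_lmarginal_eq {j} hf hm ?_
  rw [h, lmarginal_singleton]
  simp

/-- The event that arm `j` leads, but no longer does after an increase of its loss by `x`. -/
def overtaken {K : ℕ} (b x : ℝ) (L : Fin K → ℝ) (j : Fin K) : Set (Fin K → ℝ) :=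
  {r | (∀ k, L j - b * r j ≤ L k - b * r k) ∧ ∃ k, k ≠ j ∧ L k - b * r k ≤ L j + x - b * r j}

theorem measurableSet_overtaken {K : ℕ} (b x : ℝ) (L : Fin K → ℝ) (j : Fin K) :
    MeasurableSet (overtaken b x L j) := by
  unfold overtaken
  measurability

/-- For fixed perturbations of the rivals, arm `j` leads exactly when `r j` reaches the largest `r k
+ (L j - L k) / b`, and loses the lead only if it exceeds this threshold by at most `x / b`. Any
lower bound `X` for the threshold, or `X = 1`, bounds the density on that window. -/
theorem pareto_overtaken_le {α b x : ℝ} (hα : 0 < α) (hb : 0 < b) {K : ℕ}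
    (L r : Fin K → ℝ) (j : Fin K) {X : ℝ} (hX : 1 ≤ X)
    (h : X = 1 ∨ ∃ k, k ≠ j ∧ X ≤ r k + (L j - L k) / b) :
    paretoMeasure 1 α {y | Function.update r j y ∈ overtaken b x L j}
      ≤ ENNReal.ofReal (α * X ^ (-(α + 1)) * (x / b)) := by
  by_cases hne : ∃ k : Fin K, k ≠ j
  · obtain ⟨k0, hk0⟩ := hne
    obtain ⟨k1, hk1, hmax⟩ := Finset.exists_max_image (Finset.univ.erase j)
      (fun k => r k + (L j - L k) / b) ⟨k0, by simpa using hk0⟩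
    have hk1j : k1 ≠ j := by simpa using hk1
    refine (measure_mono ?_).trans (paretoMeasure_Icc_le hα (c := r k1 + (L j - L k1) / b) hX ?_)
    · rintro y ⟨h1, k, hk, h2⟩
      have h1 := h1 k1
      have h3 := hmax k (by simpa using hk)
      simp only [Function.update_self, Function.update_of_ne hk1j, Function.update_of_ne hk] at h1 h2
      constructor
      · have : (L j - L k1) / b ≤ y - r k1 := by rw [div_le_iff₀ hb]; linarith
        linarith
      · have : y - r k ≤ (L j - L k) / b + x / b := by
          rw [← add_div, le_div_iff₀ hb]; linarith
        linarith
    · rcases h with h | ⟨k, hk, h⟩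
      · exact h.le.trans (le_max_left _ _)
      · exact (h.trans (hmax k (by simpa using hk))).trans (le_max_right _ _)
  -- Without rivals nobody can overtake.
  · have : {y | Function.update r j y ∈ overtaken b x L j} = ∅ := by
      ext y
      simp only [Set.mem_ofPred_eq, Set.mem_empty_iff_false, iff_false]
      rintro ⟨_, k, hk, _⟩
      exact hne ⟨k, hk⟩
    simp [this]

theorem pertMeasure_overtaken_eq {α : ℝ} (hα : 0 < α) {K : ℕ} (b x : ℝ)
    (L : Fin K → ℝ) (j : Fin K) :
    pertMeasure α K (overtaken b x L j) = ∫⁻ r, paretoMeasure 1 α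
      {y | Function.update r j y ∈ overtaken b x L j} ∂pertMeasure α K := by
  have := isProbabilityMeasure_paretoMeasure one_pos hα
  have hm := measurableSet_overtaken b x L j
  rw [← lintegral_indicator_one hm, lintegral_pi_eq_lintegral_update _ j
    (measurable_one.indicator hm)]
  refine lintegral_congr fun r => ?_
  have hm' : MeasurableSet {y : ℝ | Function.update r j y ∈ overtaken b x L j} :=
    (measurable_update r) hm
  rw [← lintegral_indicator_one hm']
  rfl

/-- The rival is the arm of smallest loss: its perturbation is at least `1`, so the threshold is at
least `1 + gap L j / b`. -/
theorem pertMeasure_overtaken_le_gap {α b x : ℝ} (hα : 0 < α) (hb : 0 < b)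
    {K : ℕ} (L : Fin K → ℝ) (j : Fin K) :
    pertMeasure α K (overtaken b x L j)
      ≤ ENNReal.ofReal (α * (1 / (1 + gap L j / b)) ^ (α + 1) * (x / b)) := by
  have := isProbabilityMeasure_pertMeasure hα K
  have : Nonempty (Fin K) := ⟨j⟩
  obtain ⟨k, hk⟩ := exists_eq_ciInf_of_finite (f := L)
  have hg : gap L j = L j - L k := by rw [gap, hk]
  have hg0 : 0 ≤ gap L j := sub_nonneg.2 (ciInf_le (Set.finite_range L).bddBelow j)
  have hX : 1 ≤ 1 + gap L j / b := by
    have : 0 ≤ gap L j / b := by positivity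
    linarith
  rw [pertMeasure_overtaken_eq hα]
  have he : (1 / (1 + gap L j / b)) ^ (α + 1) = (1 + gap L j / b) ^ (-(α + 1)) := by
    rw [one_div, Real.inv_rpow (by linarith), Real.rpow_neg (by linarith)]
  calc _ ≤ ∫⁻ _, ENNReal.ofReal (α * (1 / (1 + gap L j / b)) ^ (α + 1) * (x / b))
        ∂pertMeasure α K := by
        refine lintegral_mono_ae ?_
        filter_upwards [ae_one_le_pertMeasure hα K] with r hr
        rw [he]
        refine pareto_overtaken_le hα hb L r j hX ?_
        by_cases hkj : k = j
        · left; rw [hg, hkj]; simp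
        · right; exact ⟨k, hkj, by rw [hg]; linarith [hr k]⟩
    _ = _ := by simp

/-- The rivals are the arms of smaller rank. None has a larger loss than `j`, whichever way ties are
broken, so the threshold is at least the maximum of their perturbations. -/
theorem pertMeasure_overtaken_le_rank {α b x : ℝ} (hα : 1 < α) (hb : 0 < b) (hx : 0 ≤ x)
    {K : ℕ} (L : Fin K → ℝ) (ρ : Equiv.Perm (Fin K)) (hρ : ∀ i j, ρ i < ρ j → L i ≤ L j)
    (j : Fin K) :
    pertMeasure α K (overtaken b x L j)
      ≤ ENNReal.ofReal (3 * α * (1 / (((ρ j : ℕ) : ℝ) + 1) ^ (1 / α)) ^ (α + 1) * (x / b)) := by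
  have hα0 : 0 < α := by linarith
  set S : Finset (Fin K) := Finset.univ.filter fun k => ρ k < ρ j with hS
  have hjS : j ∉ S := by simp [hS]
  have hc : S.card = (ρ j : ℕ) := by
    have : S = (Finset.Iio (ρ j)).map ρ.symm.toEmbedding := by
      ext k; simp [hS]
    rw [this, Finset.card_map, Fin.card_Iio]
  rw [pertMeasure_overtaken_eq hα0, ← hc]
  calc _ ≤ ∫⁻ r, ENNReal.ofReal (α * (x / b)) * ENNReal.ofReal (maxOn S r ^ (-(α + 1)))
        ∂pertMeasure α K := by
        refine lintegral_mono fun r => ?_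
        rw [← ENNReal.ofReal_mul (by positivity)]
        have h1 := one_le_maxOn hjS r
        refine (pareto_overtaken_le hα0 hb L r j h1 ?_).trans_eq (by congr 1; ring)
        rcases maxOn_eq S j r with h | ⟨k, hk, h⟩
        · exact Or.inl h
        · have hk' : ρ k < ρ j := by simpa [hS] using hk
          refine Or.inr ⟨k, fun hkj => by simp [hkj] at hk', ?_⟩
          have : 0 ≤ (L j - L k) / b := div_nonneg (sub_nonneg.2 (hρ _ _ hk')) hb.le
          linarith
    _ ≤ _ := by
        rw [lintegral_const_mul' _ _ ENNReal.ofReal_ne_top]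
        refine (mul_le_mul_right (lintegral_maxOn_rpow_le hα hjS) _).trans_eq ?_
        rw [← ENNReal.ofReal_mul (by positivity)]
        congr 1; ring

/-- Stability: an increase of the loss of arm `j` by `x` changes the probability that `j` leads by
`O(x / b)` times a factor that is controlled by the loss gap and by the rank of `j`. -/
theorem measureReal_overtaken_le {α b x : ℝ} (hα : 1 < α) (hb : 0 < b) (hx : 0 ≤ x)
    {K : ℕ} (L : Fin K → ℝ) (ρ : Equiv.Perm (Fin K)) (hρ : ∀ i j, ρ i < ρ j → L i ≤ L j)
    (j : Fin K) :
    (pertMeasure α K).real (overtaken b x L j)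
      ≤ 3 * α * (x / b) * exploreWeight α b⁻¹ L ρ j ^ 2 := by
  have hα0 : 0 < α := by linarith
  have hg0 : 0 ≤ gap L j := sub_nonneg.2 (ciInf_le (Set.finite_range L).bddBelow j)
  -- The exponent `(α + 1) / 2` in the weights is half of that in the stability bounds, so squaring
  -- recovers the latter.
  have hw : exploreWeight α b⁻¹ L ρ j ^ 2
      = (min (1 / (1 + gap L j / b)) (1 / (((ρ j : ℕ) : ℝ) + 1) ^ (1 / α))) ^ (α + 1) := by
    rw [exploreWeight, ← Real.rpow_natCast, ← Real.rpow_mul (by positivity), inv_mul_eq_div]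
    congr 1; push_cast; ring
  rw [hw, measureReal_def]
  refine ENNReal.toReal_le_of_le_ofReal (by positivity) ?_
  rcases le_total (1 / (1 + gap L j / b)) (1 / (((ρ j : ℕ) : ℝ) + 1) ^ (1 / α)) with h | h
  · rw [min_eq_left h]
    refine (pertMeasure_overtaken_le_gap hα0 hb L j).trans (ENNReal.ofReal_le_ofReal ?_)
    have : 0 ≤ α * (1 / (1 + gap L j / b)) ^ (α + 1) * (x / b) := by positivity
    linarith
  · rw [min_eq_right h]
    refine (pertMeasure_overtaken_le_rank hα hb hx L ρ hρ j).trans_eq ?_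
    congr 1; ring

/-! ### The potential and the analysis of one round. -/

/-- The perturbed cumulative loss of the perturbed leader. -/
noncomputable def leaderLoss {K : ℕ} (b : ℝ) (L r : Fin K → ℝ) : ℝ := ⨅ i, (L i - b * r i)

/-- The expected perturbed cumulative loss of the perturbed leader. -/
noncomputable def potential (α : ℝ) {K : ℕ} (b : ℝ) (L : Fin K → ℝ) : ℝ :=
  ∫ r, leaderLoss b L r ∂pertMeasure α K

/-- The bound for the expected maximum of the perturbations. -/
noncomputable def pertBound (α : ℝ) (K : ℕ) : ℝ := (1 + α / (α - 1)) * (K : ℝ) ^ (1 / α)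

section

variable {K : ℕ}

theorem leaderLoss_le (b : ℝ) (L r : Fin K → ℝ) (i : Fin K) : leaderLoss b L r ≤ L i - b * r i :=
  ciInf_le (Set.finite_range fun i => L i - b * r i).bddBelow i

theorem le_leaderLoss [NeZero K] {b c : ℝ} {L r : Fin K → ℝ} (h : ∀ i, c ≤ L i - b * r i) :
    c ≤ leaderLoss b L r := le_ciInf h

theorem leaderLoss_eq_argmin [NeZero K] (b : ℝ) (L r : Fin K → ℝ) :
    leaderLoss b L r = L (argmin fun i => L i - b * r i) - b * r (argmin fun i => L i - b * r i) :=
  le_antisymm (leaderLoss_le _ _ _ _) (le_leaderLoss fun i => argmin_le (fun i => L i - b * r i) i)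

theorem measurable_leaderLoss (b : ℝ) :
    Measurable fun x : (Fin K → ℝ) × (Fin K → ℝ) => leaderLoss b x.1 x.2 := by
  unfold leaderLoss
  refine Measurable.iInf fun i => ?_
  fun_prop

theorem measurable_potential {α : ℝ} (hα : 0 < α) (b : ℝ) :
    Measurable (potential α (K := K) b) := by
  have := isProbabilityMeasure_pertMeasure hα K
  exact ((measurable_leaderLoss b).stronglyMeasurable.integral_prod_right
    (ν := pertMeasure α K)).measurable

/-- Bernoulli's inequality for the exponent `1 - s ≤ 1` makes the sum telescope. It serves both for
the sum over ranks and for the sum of the learning rates. -/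
theorem sum_rpow_neg_le {s : ℝ} (hs0 : 0 ≤ s) (hs : s < 1) (n : ℕ) :
    ∑ m ∈ Finset.range n, ((m : ℝ) + 1) ^ (-s) ≤ (n : ℝ) ^ (1 - s) / (1 - s) := by
  have h1s : 0 < 1 - s := by linarith
  induction n with
  | zero => simp [Real.zero_rpow h1s.ne']
  | succ n ih =>
    rw [Finset.sum_range_succ]
    have hn : (0 : ℝ) < (n : ℝ) + 1 := by positivity
    have h1 : (n : ℝ) ^ (1 - s) ≤ ((n : ℝ) + 1) ^ (1 - s) - (1 - s) * ((n : ℝ) + 1) ^ (-s) := by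
      have h2 := rpow_one_add_le_one_add_mul_self (s := -1 / ((n : ℝ) + 1)) (p := 1 - s)
        (by rw [le_div_iff₀ hn]; linarith) h1s.le (by linarith)
      have h3 : (1 : ℝ) + -1 / ((n : ℝ) + 1) = n / ((n : ℝ) + 1) := by field_simp; ring
      rw [h3, Real.div_rpow (by positivity) hn.le, div_le_iff₀ (by positivity)] at h2
      have h4 : ((n : ℝ) + 1) ^ (1 - s) = ((n : ℝ) + 1) * ((n : ℝ) + 1) ^ (-s) := by
        rw [sub_eq_add_neg, Real.rpow_add hn, Real.rpow_one]
      rw [h4] at h2 ⊢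
      refine h2.trans_eq ?_
      field_simp
      ring
    have h5 : ((n : ℝ) + 1) ^ (-s) ≤
        (((n : ℝ) + 1) ^ (1 - s) - (n : ℝ) ^ (1 - s)) / (1 - s) := by
      rw [le_div_iff₀ h1s]; linarith
    push_cast
    rw [sub_div] at h5
    linarith

/-- Only the rank part of the weights matters: it bounds the weight of rank `σ` by `σ ^ (-s)` with
`s = (α + 1) / (2 * α) < 1`, and the ranks run through `1, …, K` once each. -/
theorem sum_exploreWeight_sq_le {α η : ℝ} (hα : 1 < α) (hη : 0 < η) (L : Fin K → ℝ)
    (ρ : Equiv.Perm (Fin K)) :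
    (∑ j, exploreWeight α η L ρ j) ^ 2 ≤ (2 * α / (α - 1)) ^ 2 * (K : ℝ) ^ (1 - 1 / α) := by
  have hα0 : 0 < α := by linarith
  have hα1 : 0 < α - 1 := by linarith
  set s : ℝ := (α + 1) / (2 * α) with hs
  have hs1 : s < 1 := by rw [hs, div_lt_one (by positivity)]; linarith
  have h1s : 1 - s = (α - 1) / (2 * α) := by rw [hs]; field_simp; ring
  have hw : ∀ j, exploreWeight α η L ρ j ≤ (((ρ j : ℕ) : ℝ) + 1) ^ (-s) := by
    intro j
    have hg0 : 0 ≤ gap L j := sub_nonneg.2 (ciInf_le (Set.finite_range L).bddBelow j)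
    have hr : (0 : ℝ) ≤ ((ρ j : ℕ) : ℝ) + 1 := by positivity
    refine (Real.rpow_le_rpow (by positivity) (min_le_right _ _) (by positivity)).trans_eq ?_
    rw [one_div, ← Real.rpow_neg hr, ← Real.rpow_mul hr]
    congr 1; rw [hs]; field_simp
  have hsum : ∑ j, exploreWeight α η L ρ j ≤ (K : ℝ) ^ (1 - s) / (1 - s) := by
    refine (Finset.sum_le_sum fun j _ => hw j).trans ?_
    rw [Equiv.sum_comp ρ fun k : Fin K => (((k : ℕ) : ℝ) + 1) ^ (-s),
      Fin.sum_univ_eq_sum_range fun m : ℕ => ((m : ℝ) + 1) ^ (-s)]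
    exact sum_rpow_neg_le (by positivity) hs1 K
  refine (pow_le_pow_left₀ (Finset.sum_nonneg fun j _ => (exploreWeight_pos hη L ρ j).le)
    hsum 2).trans_eq ?_
  rw [div_pow, ← Real.rpow_natCast ((K : ℝ) ^ (1 - s)), ← Real.rpow_mul (by positivity), h1s]
  have : (α - 1) / (2 * α) * ((2 : ℕ) : ℝ) = 1 - 1 / α := by push_cast; field_simp
  rw [this]
  field_simp

variable [NeZero K]

theorem integrable_leaderLoss {α : ℝ} (hα : 1 < α) (b : ℝ) (L : Fin K → ℝ) :
    Integrable (leaderLoss b L) (pertMeasure α K) := by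
  have hα0 : 0 < α := by linarith
  have := isProbabilityMeasure_pertMeasure hα0 K
  have hi : ∀ i : Fin K, Integrable (fun r : Fin K → ℝ => L i - b * r i) (pertMeasure α K) :=
    fun i => (integrable_const _).sub
      ((integrable_comp_eval_pertMeasure hα0 i (integrable_id_paretoMeasure hα)).const_mul b)
  refine (integrable_finsetSum Finset.univ fun i _ => (hi i).abs).mono' ?_ ?_
  · exact ((measurable_leaderLoss b).comp (measurable_const.prodMk measurable_id)).aestronglyMeasurable
  · refine Filter.Eventually.of_forall fun r => ?_
    rw [leaderLoss_eq_argmin, Real.norm_eq_abs]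
    exact Finset.single_le_sum (f := fun i => |L i - b * r i|) (fun i _ => abs_nonneg _)
      (Finset.mem_univ _)

theorem potential_le {α : ℝ} (hα : 1 < α) {b : ℝ} (hb : 0 ≤ b) (L : Fin K → ℝ) (i : Fin K) :
    potential α b L ≤ L i := by
  have hα0 : 0 < α := by linarith
  have := isProbabilityMeasure_pertMeasure hα0 K
  calc potential α b L ≤ ∫ _, L i ∂pertMeasure α K := by
        refine integral_mono_ae (integrable_leaderLoss hα b L) (integrable_const _) ?_
        filter_upwards [ae_one_le_pertMeasure hα0 K] with r hr
        have := leaderLoss_le b L r i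
        nlinarith [hr i]
    _ = L i := by simp

/-- The leader for scale `b'` is a competitor for scale `b`; its perturbed loss changes by `(b' - b)
* r i`, which the dominating perturbation bounds. -/
theorem potential_le_potential_add {α : ℝ} (hα : 1 < α) {b b' : ℝ} (hb : b ≤ b')
    (L : Fin K → ℝ) : potential α b L ≤ potential α b' L + (b' - b) * pertBound α K := by
  obtain ⟨M, hMi, hM, hMe⟩ := exists_dominating_perturbation hα K
  rw [pertBound, ← hMe, ← integral_const_mul, potential, potential,
    ← integral_add (integrable_leaderLoss hα b' L) (hMi.const_mul _)]
  refine integral_mono (integrable_leaderLoss hα b L)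
    ((integrable_leaderLoss hα b' L).add (hMi.const_mul _)) fun r => ?_
  simp only
  rw [leaderLoss_eq_argmin b' L r]
  set i := argmin fun i => L i - b' * r i
  have := leaderLoss_le b L r i
  nlinarith [hM r i]

theorem neg_le_potential {α : ℝ} (hα : 1 < α) {b : ℝ} (hb : 0 ≤ b) {L : Fin K → ℝ}
    (hL : ∀ i, 0 ≤ L i) : -(b * pertBound α K) ≤ potential α b L := by
  obtain ⟨M, hMi, hM, hMe⟩ := exists_dominating_perturbation hα K
  rw [pertBound, ← hMe, ← integral_const_mul, potential, ← integral_neg]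
  refine integral_mono (hMi.const_mul _).neg (integrable_leaderLoss hα b L) fun r => ?_
  refine le_leaderLoss fun i => ?_
  nlinarith [hM r i, hL i]

theorem measurableSet_argmin_eq (b : ℝ) (L : Fin K → ℝ) (j : Fin K) :
    MeasurableSet {r : Fin K → ℝ | (argmin fun i => L i - b * r i) = j} := by
  have : Measurable fun r : Fin K → ℝ => argmin fun i => L i - b * r i :=
    measurable_argmin.comp (by fun_prop)
  exact this (measurableSet_singleton j)

/-- Where `j` still leads after the increase, its own perturbed loss before the increase shows that
the minimum rose by at least `x`; elsewhere the minimum did not fall. Having the probability after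
the increase on the left is what creates the stability term. -/
theorem potential_add_single {α : ℝ} (hα : 1 < α) (b x : ℝ) (L : Fin K → ℝ) (j : Fin K) :
    x * (pertMeasure α K).real {r | (argmin fun i => (L + Pi.single j x : Fin K → ℝ) i - b * r i) = j}
      ≤ potential α b (L + Pi.single j x) - potential α b L := by
  have hα0 : 0 < α := by linarith
  have := isProbabilityMeasure_pertMeasure hα0 K
  have hm := measurableSet_argmin_eq b (L + Pi.single j x) j
  rw [potential, potential, ← integral_sub (integrable_leaderLoss hα b _)
    (integrable_leaderLoss hα b _), ← integral_indicator_one hm, ← integral_const_mul]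
  refine integral_mono (((integrable_const (1 : ℝ)).indicator hm).const_mul x)
    ((integrable_leaderLoss hα b _).sub (integrable_leaderLoss hα b _)) fun r => ?_
  simp only
  have e := leaderLoss_eq_argmin b (L + Pi.single j x) r
  rw [e]
  set i := argmin fun i => (L + Pi.single j x : Fin K → ℝ) i - b * r i with hi
  have h1 := leaderLoss_le b L r i
  by_cases hij : i = j
  · rw [Set.indicator_of_mem (by exact hij)]
    simp only [Pi.one_apply, Pi.add_apply, hij, Pi.single_eq_same] at h1 ⊢
    linarith
  · rw [Set.indicator_of_notMem (by exact hij)]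
    simp only [Pi.add_apply, Pi.single_eq_of_ne hij] at h1 ⊢
    linarith

/-- If `j` loses the lead, the new leader is the arm required by `overtaken`. -/
theorem measureReal_argmin_eq_le {α : ℝ} (hα : 0 < α) (b x : ℝ) (L : Fin K → ℝ) (j : Fin K) :
    (pertMeasure α K).real {r | (argmin fun i => L i - b * r i) = j}
      ≤ (pertMeasure α K).real {r | (argmin fun i => (L + Pi.single j x : Fin K → ℝ) i - b * r i) = j}
        + (pertMeasure α K).real (overtaken b x L j) := by
  have := isProbabilityMeasure_pertMeasure hα K
  refine (measureReal_mono fun r hr => ?_).trans (measureReal_union_le _ _)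
  have hr : (argmin fun i => L i - b * r i) = j := hr
  by_cases h : (argmin fun i => (L + Pi.single j x : Fin K → ℝ) i - b * r i) = j
  · exact Or.inl h
  · right
    refine ⟨fun k => hr ▸ argmin_le (fun i => L i - b * r i) k, _, h, ?_⟩
    have := argmin_le (fun i => (L + Pi.single j x : Fin K → ℝ) i - b * r i) j
    simp only [Pi.add_apply] at h
    simpa [Pi.single_eq_of_ne h] using this

theorem integral_comp_argmin {α : ℝ} (hα : 0 < α) (b : ℝ) (L ℓ : Fin K → ℝ) :
    ∫ r, ℓ (argmin fun i => L i - b * r i) ∂pertMeasure α K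
      = ∑ j, ℓ j * (pertMeasure α K).real {r | (argmin fun i => L i - b * r i) = j} := by
  have := isProbabilityMeasure_pertMeasure hα K
  have h : ∀ r : Fin K → ℝ, ℓ (argmin fun i => L i - b * r i)
      = ∑ j, ℓ j * {r : Fin K → ℝ | (argmin fun i => L i - b * r i) = j}.indicator 1 r := by
    intro r
    rw [Finset.sum_eq_single (argmin fun i => L i - b * r i)]
    · rw [Set.indicator_of_mem (by exact rfl)]; simp
    · intro j _ hj
      rw [Set.indicator_of_notMem (by exact hj.symm)]; simp
    · simp
  simp_rw [h]
  rw [integral_finsetSum]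
  · refine Finset.sum_congr rfl fun j _ => ?_
    rw [integral_const_mul, integral_indicator_one (measurableSet_argmin_eq b L j)]
  · exact fun j _ => ((integrable_const (1 : ℝ)).indicator
      (measurableSet_argmin_eq b L j)).const_mul _

theorem exploreProb_pos {α η : ℝ} (hη : 0 < η) (L : Fin K → ℝ) (ρ : Equiv.Perm (Fin K))
    (i : Fin K) : 0 < exploreProb α η L ρ i :=
  div_pos (exploreWeight_pos hη L ρ i)
    (Finset.sum_pos (fun j _ => exploreWeight_pos hη L ρ j) Finset.univ_nonempty)

/-- One round of follow-the-perturbed-leader: the expected loss of the exploited arm is at most the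
expected increase of the potential, up to the stability term. -/
theorem integral_exploit_le {α b : ℝ} (hα : 1 < α) (hb : 0 < b) (L : Fin K → ℝ)
    (ρ : Equiv.Perm (Fin K)) (hρ : ∀ i j, ρ i < ρ j → L i ≤ L j) {ℓ : Fin K → ℝ}
    (h0 : ∀ i, 0 ≤ ℓ i) (h1 : ∀ i, ℓ i ≤ 1) :
    ∫ r, ℓ (argmin fun i => L i - b * r i) ∂pertMeasure α K
      ≤ ∑ j, exploreProb α b⁻¹ L ρ j *
          (potential α b (L + Pi.single j (ℓ j / exploreProb α b⁻¹ L ρ j)) - potential α b L)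
        + 3 * α * b⁻¹ * (∑ j, exploreWeight α b⁻¹ L ρ j) ^ 2 := by
  have hα0 : 0 < α := by linarith
  set Q := ∑ j, exploreWeight α b⁻¹ L ρ j with hQ
  have hb' : 0 < b⁻¹ := inv_pos.2 hb
  have hq : ∀ j, 0 < exploreWeight α b⁻¹ L ρ j := exploreWeight_pos hb' L ρ
  have hQ0 : 0 < Q := Finset.sum_pos (fun j _ => hq j) Finset.univ_nonempty
  rw [integral_comp_argmin hα0]
  calc _ ≤ ∑ j, (exploreProb α b⁻¹ L ρ j *
          (potential α b (L + Pi.single j (ℓ j / exploreProb α b⁻¹ L ρ j)) - potential α b L)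
          + 3 * α * b⁻¹ * Q * exploreWeight α b⁻¹ L ρ j) := by
        refine Finset.sum_le_sum fun j _ => ?_
        have hp := exploreProb_pos (α := α) hb' L ρ j
        have hpe : exploreProb α b⁻¹ L ρ j = exploreWeight α b⁻¹ L ρ j / Q := rfl
        set p := exploreProb α b⁻¹ L ρ j
        set q := exploreWeight α b⁻¹ L ρ j with hqdef
        have hqj : 0 < q := hq j
        have hx : 0 ≤ ℓ j / p := div_nonneg (h0 j) hp.le
        have e1 := measureReal_argmin_eq_le hα0 b (ℓ j / p) L j
        have e2 := measureReal_overtaken_le hα hb hx L ρ hρ j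
        have e3 := potential_add_single hα b (ℓ j / p) L j
        rw [← hqdef] at e2
        set A := (pertMeasure α K).real {r | (argmin fun i => L i - b * r i) = j}
        set B := (pertMeasure α K).real
          {r | (argmin fun i => (L + Pi.single j (ℓ j / p) : Fin K → ℝ) i - b * r i) = j}
        have e4 : ℓ j * A ≤ ℓ j * B + ℓ j * (3 * α * (ℓ j / p / b) * q ^ 2) := by
          rw [← mul_add]
          exact mul_le_mul_of_nonneg_left (by linarith) (h0 j)
        have e5 : ℓ j * B ≤ p * (potential α b (L + Pi.single j (ℓ j / p)) - potential α b L) := by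
          have := mul_le_mul_of_nonneg_left e3 hp.le
          rwa [← mul_assoc, mul_div_cancel₀ _ hp.ne'] at this
        -- As `p = q / Q`, the quotient `q ^ 2 / p` is `Q * q`, and summing over the arms leaves `Q
        -- ^ 2`.
        have e6 : ℓ j * (3 * α * (ℓ j / p / b) * q ^ 2) = ℓ j ^ 2 * (3 * α * b⁻¹ * Q * q) := by
          rw [hpe]; field_simp
        have e7 : ℓ j ^ 2 * (3 * α * b⁻¹ * Q * q) ≤ 3 * α * b⁻¹ * Q * q :=
          mul_le_of_le_one_left (by positivity) (pow_le_one₀ (h0 j) (h1 j))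
        linarith
    _ = _ := by
        rw [Finset.sum_add_distrib, ← Finset.mul_sum, ← hQ]
        ring

end

/-! ### Integration over histories, one round at a time. -/

/-- Bounded measurable real functions. -/
def BddMeasurable {X : Type*} [MeasurableSpace X] (f : X → ℝ) : Prop :=
  Measurable f ∧ ∃ C, ∀ x, |f x| ≤ C

namespace BddMeasurable

variable {X Y : Type*} [MeasurableSpace X] [MeasurableSpace Y] {f g : X → ℝ}

theorem of_mem_Icc {a b : ℝ} (hf : Measurable f) (h : ∀ x, f x ∈ Set.Icc a b) :
    BddMeasurable f :=
  ⟨hf, max |a| |b|, fun x => abs_le_max_abs_abs (h x).1 (h x).2⟩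

theorem const (c : ℝ) : BddMeasurable fun _ : X => c := ⟨measurable_const, |c|, fun _ => le_rfl⟩

theorem add (hf : BddMeasurable f) (hg : BddMeasurable g) : BddMeasurable fun x => f x + g x := by
  obtain ⟨hf, C, hC⟩ := hf
  obtain ⟨hg, D, hD⟩ := hg
  exact ⟨hf.add hg, C + D, fun x => (abs_add_le _ _).trans (add_le_add (hC x) (hD x))⟩

theorem sum {ι : Type*} (s : Finset ι) {F : ι → X → ℝ} (h : ∀ i ∈ s, BddMeasurable (F i)) :
    BddMeasurable fun x => ∑ i ∈ s, F i x := by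
  classical
  induction s using Finset.induction_on with
  | empty => simpa using const 0
  | insert i s hi ih =>
    simp only [Finset.sum_insert hi]
    exact (h i (by simp)).add (ih fun k hk => h k (by simp [hk]))

theorem comp (hf : BddMeasurable f) {φ : Y → X} (hφ : Measurable φ) :
    BddMeasurable fun y => f (φ y) :=
  ⟨hf.1.comp hφ, hf.2.imp fun _ hC y => hC (φ y)⟩

theorem integrable (hf : BddMeasurable f) (μ : Measure X) [IsFiniteMeasure μ] : Integrable f μ := by
  obtain ⟨hf, C, hC⟩ := hf
  exact Integrable.of_bound hf.aestronglyMeasurable C (Filter.Eventually.of_forall hC)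

end BddMeasurable

section History

variable {K t : ℕ}

instance (π : Policy K) (env : Environment K) (t : ℕ) : IsMarkovKernel (roundKernel π env t) := by
  unfold roundKernel; infer_instance

theorem measurable_snoc :
    Measurable fun x : (Fin t → Round K) × Round K =>
      (Fin.snoc (α := fun _ => Round K) x.1 x.2 : Fin (t + 1) → Round K) := by
  refine measurable_pi_lambda _ fun s => ?_
  refine Fin.lastCases ?_ (fun s => ?_) s
  · simpa using measurable_snd
  · simpa [Function.comp_def] using (measurable_pi_apply s).comp measurable_fst

theorem measurable_init : Measurable fun h : Fin (t + 1) → Round K => (Fin.init h : Fin t → Round K) :=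
  measurable_pi_lambda _ fun s => measurable_pi_apply s.castSucc

instance isProbabilityMeasure_historyMeasure (π : Policy K) (env : Environment K) (t : ℕ) :
    IsProbabilityMeasure (historyMeasure π env t) := by
  induction t with
  | zero => rw [historyMeasure]; infer_instance
  | succ t ih =>
    rw [historyMeasure]
    exact Measure.isProbabilityMeasure_map measurable_snoc.aemeasurable

theorem roundKernel_apply (π : Policy K) (env : Environment K) (t : ℕ) (h : Fin t → Round K) :
    roundKernel π env t h = (env.kernel t h).prod (π.kernel t (observe h)) := by
  rw [roundKernel, Kernel.prod_apply, Kernel.comap_apply]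

theorem observe_snoc (h : Fin t → Round K) (x : Round K) :
    observe (Fin.snoc (α := fun _ => Round K) h x : Fin (t + 1) → Round K)
      = Fin.snoc (α := fun _ => Obs K) (observe h) (x.2, x.1 x.2.2) := by
  funext s
  refine Fin.lastCases ?_ (fun s => ?_) s <;> simp [observe]

theorem integral_historyMeasure_succ (π : Policy K) (env : Environment K) (t : ℕ)
    {f : (Fin (t + 1) → Round K) → ℝ} (hf : BddMeasurable f) :
    ∫ h, f h ∂historyMeasure π env (t + 1)
      = ∫ h, ∫ x, f (Fin.snoc (α := fun _ => Round K) h x) ∂roundKernel π env t h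
          ∂historyMeasure π env t := by
  rw [historyMeasure, integral_map measurable_snoc.aemeasurable hf.1.aestronglyMeasurable,
    Measure.integral_compProd ((hf.comp measurable_snoc).integrable _)]

theorem integral_historyMeasure_init (π : Policy K) (env : Environment K) (t : ℕ)
    {f : (Fin t → Round K) → ℝ} (hf : BddMeasurable f) :
    ∫ h, f (Fin.init h) ∂historyMeasure π env (t + 1) = ∫ h, f h ∂historyMeasure π env t := by
  rw [integral_historyMeasure_succ π env t (hf.comp measurable_init)]
  simp

theorem integrable_integral_roundKernel (π : Policy K) (env : Environment K)
    {f : (Fin t → Round K) × Round K → ℝ} (hf : BddMeasurable f) :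
    Integrable (fun h => ∫ x, f (h, x) ∂roundKernel π env t h) (historyMeasure π env t) := by
  obtain ⟨hm, C, hC⟩ := hf
  refine Integrable.of_bound (StronglyMeasurable.integral_kernel_prod_right'
    hm.stronglyMeasurable).aestronglyMeasurable C (Filter.Eventually.of_forall fun h => ?_)
  refine (norm_integral_le_of_norm_le_const (C := C) (Filter.Eventually.of_forall
    fun x => hC (h, x))).trans_eq ?_
  simp

theorem integral_historyMeasure_succ_mono (π : Policy K) (env : Environment K) (t : ℕ)
    {f g : (Fin (t + 1) → Round K) → ℝ} (hf : BddMeasurable f) (hg : BddMeasurable g)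
    (h : ∀ h : Fin t → Round K, ∫ x, f (Fin.snoc (α := fun _ => Round K) h x) ∂roundKernel π env t h
      ≤ ∫ x, g (Fin.snoc (α := fun _ => Round K) h x) ∂roundKernel π env t h) :
    ∫ h, f h ∂historyMeasure π env (t + 1) ≤ ∫ h, g h ∂historyMeasure π env (t + 1) := by
  rw [integral_historyMeasure_succ π env t hf, integral_historyMeasure_succ π env t hg]
  exact integral_mono
    (integrable_integral_roundKernel π env (hf.comp measurable_snoc))
    (integrable_integral_roundKernel π env (hg.comp measurable_snoc)) h

theorem integral_sum_historyMeasure_succ (π : Policy K) (env : Environment K) (t : ℕ)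
    {g : Round K → ℝ} (hg : BddMeasurable g) :
    ∫ h, ∑ s, g (h s) ∂historyMeasure π env (t + 1)
      = ∫ h, ∑ s, g (h s) ∂historyMeasure π env t
        + ∫ h, g (h (Fin.last t)) ∂historyMeasure π env (t + 1) := by
  have hs : BddMeasurable fun h : Fin t → Round K => ∑ s, g (h s) :=
    BddMeasurable.sum _ fun s _ => hg.comp (measurable_pi_apply s)
  rw [← integral_historyMeasure_init π env t hs, ← integral_add
    ((hs.comp measurable_init).integrable _) ((hg.comp (measurable_pi_apply (Fin.last t))).integrable _)]
  simp only [Fin.sum_univ_castSucc]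
  rfl

theorem bddMeasurable_loss (i : Fin K) : BddMeasurable fun x : Round K => (x.1 i : ℝ) :=
  BddMeasurable.of_mem_Icc (measurable_subtype_coe.comp
    ((measurable_pi_apply i).comp measurable_fst)) fun x => (x.1 i).2

theorem measurable_apply_fst {X : Type*} [MeasurableSpace X] {i : X → Fin K} (hi : Measurable i)
    {ℓ : X → Fin K → Loss} (hℓ : Measurable ℓ) : Measurable fun x => ℓ x (i x) := by
  have : Measurable fun y : (Fin K → Loss) × Fin K => y.1 y.2 :=
    measurable_from_prod_countable_left fun j => measurable_pi_apply j
  exact this.comp (hℓ.prodMk hi)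

theorem bddMeasurable_exploitLoss : BddMeasurable fun x : Round K => (x.1 x.2.1 : ℝ) :=
  BddMeasurable.of_mem_Icc (measurable_subtype_coe.comp
    (measurable_apply_fst (measurable_fst.comp measurable_snd) measurable_fst)) fun x => (x.1 x.2.1).2

end History

/-! ### Conditional expectations under follow-the-perturbed-leader. -/

section Algorithm

variable {K t : ℕ}

/-- Serves integrability only, so the bound may grow arbitrarily with `t`. Bounded estimates bound
the gaps, hence the exploration probabilities from below, hence the next estimate. -/
theorem exists_bound_lossEst [NeZero K] (α : ℝ) (hα : 0 < α) {η : ℕ → ℝ} (hη : ∀ t, 0 < η t)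
    (R : RankRule K) (t : ℕ) :
    ∃ B : ℝ, ∀ h i, 0 ≤ lossEst α η R t h i ∧ lossEst α η R t h i ≤ B := by
  induction t with
  | zero => exact ⟨0, fun h i => by simp [lossEst]⟩
  | succ t ih =>
    obtain ⟨B, hB⟩ := ih
    have hK : (0 : ℝ) < K := by exact_mod_cast Nat.pos_of_neZero K
    have hB0 : 0 ≤ B := by
      by_cases hne : Nonempty (Fin t → Obs K)
      · obtain ⟨h⟩ := hne
        exact (hB h 0).1.trans (hB h 0).2
      · exact absurd ⟨fun _ => ((0, 0), 0)⟩ hne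
    -- A lower bound for every weight. Each weight is at most `1`, so their sum is at most `K` and
    -- every probability is at least `w / K`.
    set w : ℝ := (min (1 / (1 + η t * B)) (1 / (K : ℝ) ^ (1 / α))) ^ ((α + 1) / 2) with hw
    have hηt := hη t
    have hw0 : 0 < w := by positivity
    have hp : ∀ (h : Fin t → Obs K) (j : Fin K), w / K ≤ exploreProb α (η t) (lossEst α η R t h)
        (R.rank t h (lossEst α η R t h)) j := by
      intro h j
      set L := lossEst α η R t h
      set ρ := R.rank t h L
      have hg0 : ∀ i, 0 ≤ gap L i := fun i =>
        sub_nonneg.2 (ciInf_le (Set.finite_range L).bddBelow i)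
      have hgB : gap L j ≤ B := by
        have : 0 ≤ ⨅ i, L i := le_ciInf fun i => (hB h i).1
        have := (hB h j).2
        unfold gap; linarith
      have h1 : w ≤ exploreWeight α (η t) L ρ j := by
        refine Real.rpow_le_rpow (by positivity) (min_le_min ?_ ?_) (by positivity)
        · have := mul_nonneg hηt.le (hg0 j)
          gcongr
        · have : ((ρ j : ℕ) : ℝ) + 1 ≤ K := by exact_mod_cast (ρ j).2
          gcongr
      have h2 : ∑ i, exploreWeight α (η t) L ρ i ≤ K := by
        refine (Finset.sum_le_sum (g := fun _ => (1 : ℝ)) fun i _ => ?_).trans (by simp)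
        have := mul_nonneg hηt.le (hg0 i)
        refine Real.rpow_le_one (by positivity) ((min_le_left _ _).trans ?_) (by positivity)
        rw [div_le_one (by linarith)]; linarith
      exact div_le_div₀ (exploreWeight_pos hηt L ρ j).le h1
        (Finset.sum_pos (fun i _ => exploreWeight_pos hηt L ρ i) Finset.univ_nonempty) h2
    refine ⟨B + 1 / (w / K), fun h i => ?_⟩
    have hBi := hB (Fin.init h) i
    have hpi := hp (Fin.init h) i
    have hwK : 0 < w / K := by positivity
    simp only [lossEst, Pi.add_apply]
    by_cases hj : i = (h (Fin.last t)).1.2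
    · rw [← hj, Pi.single_eq_same]
      have hl := (h (Fin.last t)).2.2
      have h3 := div_nonneg hl.1 (hwK.le.trans hpi)
      exact ⟨by linarith, add_le_add hBi.2 (div_le_div₀ zero_le_one hl.2 hwK hpi)⟩
    · rw [Pi.single_eq_of_ne hj, add_zero]
      have : 0 < 1 / (w / K) := by positivity
      exact ⟨hBi.1, by linarith [hBi.2]⟩

theorem bddMeasurable_lossEst [NeZero K] (α : ℝ) (hα : 0 < α) {η : ℕ → ℝ} (hη : ∀ t, 0 < η t)
    (R : RankRule K) (t : ℕ) (i : Fin K) :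
    BddMeasurable fun h : Fin t → Round K => lossEst α η R t (observe h) i := by
  obtain ⟨B, hB⟩ := exists_bound_lossEst α hα hη R t
  exact BddMeasurable.of_mem_Icc ((measurable_pi_apply i).comp
    ((measurable_lossEst α η R t).comp measurable_observe)) fun h => hB _ i

theorem bddMeasurable_potential [NeZero K] {α : ℝ} (hα : 1 < α) {η : ℕ → ℝ} (hη : ∀ t, 0 < η t)
    (R : RankRule K) (t : ℕ) {b : ℝ} (hb : 0 ≤ b) :
    BddMeasurable fun h : Fin t → Round K => potential α b (lossEst α η R t (observe h)) := by
  obtain ⟨B, hB⟩ := exists_bound_lossEst α (by linarith) hη R t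
  exact BddMeasurable.of_mem_Icc ((measurable_potential (by linarith) b).comp
    ((measurable_lossEst α η R t).comp measurable_observe)) fun h =>
    ⟨neg_le_potential hα hb fun i => (hB _ i).1, (potential_le hα hb _ 0).trans (hB _ 0).2⟩

theorem integral_exploreKernel {α : ℝ} {η : ℕ → ℝ} [NeZero K] (hη : ∀ t, 0 < η t) (R : RankRule K)
    (h : Fin t → Obs K) (g : Fin K → ℝ) :
    ∫ j, g j ∂exploreKernel α η R t h = ∑ j, exploreDist α η R t h j * g j := by
  have : exploreKernel α η R t h
      = ∑ i, ENNReal.ofReal (exploreDist α η R t h i) • Measure.dirac i := rfl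
  rw [this, integral_finsetSum_measure]
  · refine Finset.sum_congr rfl fun j _ => ?_
    rw [integral_smul_measure, integral_dirac, ENNReal.toReal_ofReal
      (show 0 ≤ exploreDist α η R t h j from (exploreProb_pos (hη t) _ _ _).le),
      smul_eq_mul]
  · exact fun j _ => (integrable_dirac (by simp)).smul_measure ENNReal.ofReal_ne_top

theorem integral_exploitKernel {α : ℝ} (hα : 0 < α) {η : ℕ → ℝ} [NeZero K] (R : RankRule K)
    (h : Fin t → Obs K) (g : Fin K → ℝ) :
    ∫ i, g i ∂exploitKernel α η R t h
      = ∫ r, g (argmin fun i => lossEst α η R t h i - (η t)⁻¹ * r i) ∂pertMeasure α K := by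
  have := isProbabilityMeasure_pertMeasure hα K
  have hm := measurable_exploitArm α η R t
  rw [exploitKernel, Kernel.map_apply _ hm, integral_map hm.aemeasurable
    (measurable_of_countable g).aestronglyMeasurable, Kernel.prod_apply, Kernel.id_apply,
    Kernel.const_apply, Measure.dirac_prod, integral_map (f := fun x => g (exploitArm α η R t x))
    (by fun_prop) ((measurable_of_countable g).comp hm).aestronglyMeasurable]
  simp only [exploitArm, div_eq_inv_mul]

/-- The conditional expectation of a function of the two arms of follow-the-perturbed-leader. -/
theorem integral_kernel_ftpl [NeZero K] {α : ℝ} (hα : 1 < α) {η : ℕ → ℝ} (hη : ∀ t, 0 < η t)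
    (R : RankRule K) (h : Fin t → Obs K) (f : Fin K × Fin K → ℝ) :
    ∫ a, f a ∂(ftpl α hα η hη R).kernel t h
      = ∫ r, ∑ j, exploreDist α η R t h j *
          f (argmin fun i => lossEst α η R t h i - (η t)⁻¹ * r i, j) ∂pertMeasure α K := by
  have := isMarkov_exploitKernel hα η R t
  have := isMarkov_exploreKernel (α := α) hη R t
  simp only [ftpl, Kernel.prod_apply]
  rw [integral_prod _ Integrable.of_finite]
  simp only [integral_exploreKernel hη]
  exact integral_exploitKernel (by linarith) R h fun i => ∑ j, exploreDist α η R t h j * f (i, j)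

/-- Given the past, the losses are independent of the arms, so it suffices to compare for each fixed
loss vector. Hence adaptive environments need no separate treatment. -/
theorem integral_roundKernel_mono (π : Policy K) (env : Environment K) (h : Fin t → Round K)
    {f g : Round K → ℝ} (hf : BddMeasurable f) (hg : BddMeasurable g)
    (hfg : ∀ ℓ, ∫ a, f (ℓ, a) ∂π.kernel t (observe h) ≤ ∫ a, g (ℓ, a) ∂π.kernel t (observe h)) :
    ∫ x, f x ∂roundKernel π env t h ≤ ∫ x, g x ∂roundKernel π env t h := by
  rw [roundKernel_apply, integral_prod _ (hf.integrable _), integral_prod _ (hg.integrable _)]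
  exact integral_mono (hf.integrable ((env.kernel t h).prod _)).integral_prod_left
    (hg.integrable ((env.kernel t h).prod _)).integral_prod_left hfg

theorem sum_exploreDist [NeZero K] {α : ℝ} {η : ℕ → ℝ} (hη : ∀ t, 0 < η t) (R : RankRule K)
    (h : Fin t → Obs K) : ∑ j, exploreDist α η R t h j = 1 := by
  simp only [exploreDist, exploreProb]
  rw [← Finset.sum_div, div_self]
  exact (Finset.sum_pos (fun i _ => exploreWeight_pos (hη t) _ _ i) Finset.univ_nonempty).ne'

theorem lossEst_observe_snoc (α : ℝ) (η : ℕ → ℝ) (R : RankRule K) (h : Fin t → Round K)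
    (x : Round K) :
    lossEst α η R (t + 1) (observe (Fin.snoc (α := fun _ => Round K) h x))
      = lossEst α η R t (observe h) + Pi.single x.2.2
        ((x.1 x.2.2 : ℝ) / exploreDist α η R t (observe h) x.2.2) := by
  simp [observe_snoc, lossEst, exploreDist]

end Algorithm

/-! ### The regret bound. -/

section UpperBound

variable {K t : ℕ} [NeZero K]

theorem sum_exploreDist_mul_add {α : ℝ} {η : ℕ → ℝ} (hη : ∀ t, 0 < η t) (R : RankRule K)
    (h : Fin t → Obs K) (u : Fin K → ℝ) (c : ℝ) :
    ∑ j, exploreDist α η R t h j * (u j + c) = ∑ j, exploreDist α η R t h j * u j + c := by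
  simp only [mul_add, Finset.sum_add_distrib, ← Finset.sum_mul, sum_exploreDist hη, one_mul]

/-- The bound for the stability term of one round. -/
noncomputable def stabilityBound (α η : ℝ) (K : ℕ) : ℝ :=
  3 * α * η * ((2 * α / (α - 1)) ^ 2 * (K : ℝ) ^ (1 - 1 / α))

theorem integral_roundKernel_exploitLoss_le {α : ℝ} (hα : 1 < α) {η : ℕ → ℝ} (hη : ∀ t, 0 < η t)
    (R : RankRule K) (env : Environment K) (h : Fin t → Round K) :
    ∫ x : Round K, ((x.1 x.2.1 : ℝ) + potential α (η t)⁻¹ (lossEst α η R t (observe h)))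
        ∂roundKernel (ftpl α hα η hη R) env t h
      ≤ ∫ x, (potential α (η t)⁻¹ (lossEst α η R (t + 1)
          (observe (Fin.snoc (α := fun _ => Round K) h x))) + stabilityBound α (η t) K)
        ∂roundKernel (ftpl α hα η hη R) env t h := by
  have hα0 : 0 < α := by linarith
  have := isProbabilityMeasure_pertMeasure hα0 K
  have hb : 0 < (η t)⁻¹ := inv_pos.2 (hη t)
  refine integral_roundKernel_mono _ env h
    (bddMeasurable_exploitLoss.add (BddMeasurable.const _))
    (((bddMeasurable_potential hα hη R (t + 1) hb.le).comp
      (measurable_snoc.comp measurable_prodMk_left)).add (BddMeasurable.const _)) fun ℓ => ?_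
  simp only [integral_kernel_ftpl hα hη, lossEst_observe_snoc]
  set L := lossEst α η R t (observe h) with hL
  simp only [sum_exploreDist_mul_add hη, ← Finset.sum_mul, sum_exploreDist hη, one_mul]
  have h1 := integral_exploit_le hα hb L (R.rank t (observe h) L)
    (R.sorted t (observe h) L) (fun i => (ℓ i).2.1) fun i => (ℓ i).2.2
  have h2 := sum_exploreWeight_sq_le hα (hη t) L (R.rank t (observe h) L)
  have h3 : ∀ j, exploreProb α (η t) L (R.rank t (observe h) L) j
      = exploreDist α η R t (observe h) j := fun j => rfl
  simp only [inv_inv, h3] at h1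
  have h4 : 3 * α * η t * (∑ j, exploreWeight α (η t) L (R.rank t (observe h) L) j) ^ 2
      ≤ stabilityBound α (η t) K := by
    have := (hη t).le
    exact mul_le_mul_of_nonneg_left h2 (by positivity)
  simp only [mul_sub, Finset.sum_sub_distrib, ← Finset.sum_mul, sum_exploreDist hη, one_mul] at h1
  have hm : Measurable fun r : Fin K → ℝ => (ℓ (argmin fun i => L i - (η t)⁻¹ * r i) : ℝ) :=
    (measurable_of_countable fun i => (ℓ i : ℝ)).comp (measurable_argmin.comp (by fun_prop))
  have hi : Integrable (fun r : Fin K → ℝ => (ℓ (argmin fun i => L i - (η t)⁻¹ * r i) : ℝ))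
      (pertMeasure α K) :=
    (BddMeasurable.of_mem_Icc hm fun r => (ℓ _).2).integrable _
  rw [integral_add hi (integrable_const _)]
  simp only [integral_const, probReal_univ, smul_eq_mul, one_mul]
  linarith

/-- The scale `b` is free so that the induction can change it: round `t` is analysed at scale `(η
t)⁻¹`, and the passage to a larger scale is paid in multiples of `pertBound α K`, which telescope to
`b * pertBound α K`. -/
theorem integral_exploitLoss_le {α : ℝ} (hα : 1 < α) {η : ℕ → ℝ} (hη : ∀ t, 0 < η t)
    (hmono : Antitone η) (R : RankRule K) (env : Environment K) (T : ℕ) {b : ℝ} (hb0 : 0 ≤ b)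
    (hb : ∀ s < T, (η s)⁻¹ ≤ b) :
    ∫ h, ∑ s, ((h s).1 (h s).2.1 : ℝ) ∂historyMeasure (ftpl α hα η hη R) env T
      ≤ ∫ h, potential α b (lossEst α η R T (observe h))
          ∂historyMeasure (ftpl α hα η hη R) env T
        + b * pertBound α K + ∑ s ∈ Finset.range T, stabilityBound α (η s) K := by
  set π := ftpl α hα η hη R with hπ
  have hα0 : 0 < α := by linarith
  induction T generalizing b with
  | zero =>
    -- With no rounds played the potential is minus `b` times the expected largest perturbation.
    have h1 : -(b * pertBound α K) ≤ ∫ h, potential α b (lossEst α η R 0 (observe h))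
        ∂historyMeasure π env 0 := by
      have : ∫ _, -(b * pertBound α K) ∂historyMeasure π env 0 = -(b * pertBound α K) := by simp
      rw [← this]
      refine integral_mono (integrable_const _)
        ((bddMeasurable_potential hα hη R 0 hb0).integrable _) fun h => ?_
      exact neg_le_potential hα hb0 fun i => by simp [lossEst]
    simp only [Finset.univ_eq_empty, Finset.sum_empty, integral_zero, Finset.range_zero]
    linarith
  | succ t ih =>
    have hbt : (η t)⁻¹ ≤ b := hb t t.lt_succ_self
    have hbt0 : 0 ≤ (η t)⁻¹ := (inv_pos.2 (hη t)).le
    have hg := bddMeasurable_exploitLoss (K := K)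
    have hP := fun s => bddMeasurable_potential hα hη R s hbt0
    have hPb := bddMeasurable_potential hα hη R (t + 1) hb0
    -- Antitone rates make `(η t)⁻¹` admissible as scale for all earlier rounds.
    have h1 := ih hbt0 fun s hs => inv_anti₀ (hη t) (hmono hs.le)
    have h2 : ∫ h, ((h (Fin.last t)).1 (h (Fin.last t)).2.1 : ℝ) ∂historyMeasure π env (t + 1)
        + ∫ h, potential α (η t)⁻¹ (lossEst α η R t (observe h)) ∂historyMeasure π env t
        ≤ ∫ h, potential α (η t)⁻¹ (lossEst α η R (t + 1) (observe h))
            ∂historyMeasure π env (t + 1) + stabilityBound α (η t) K := by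
      have h3 := integral_historyMeasure_succ_mono π env t
        ((hg.comp (measurable_pi_apply (Fin.last t))).add ((hP t).comp measurable_init))
        ((hP (t + 1)).add (BddMeasurable.const (stabilityBound α (η t) K))) fun h => by
          simpa only [Fin.init_snoc, Fin.snoc_last] using
            integral_roundKernel_exploitLoss_le hα hη R env h
      rw [integral_add ((hg.comp (measurable_pi_apply (Fin.last t))).integrable _)
        (((hP t).comp measurable_init).integrable _), integral_historyMeasure_init π env t (hP t),
        integral_add ((hP (t + 1)).integrable _) (integrable_const _)] at h3
      simpa using h3
    have h4 : ∫ h, potential α (η t)⁻¹ (lossEst α η R (t + 1) (observe h))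
          ∂historyMeasure π env (t + 1)
        ≤ ∫ h, potential α b (lossEst α η R (t + 1) (observe h)) ∂historyMeasure π env (t + 1)
          + (b - (η t)⁻¹) * pertBound α K := by
      have : (b - (η t)⁻¹) * pertBound α K
        = ∫ _, (b - (η t)⁻¹) * pertBound α K ∂historyMeasure π env (t + 1) := by simp
      rw [this, ← integral_add (hPb.integrable _) (integrable_const _)]
      exact integral_mono ((hP (t + 1)).integrable _)
        ((hPb.integrable _).add (integrable_const _))
        fun h => potential_le_potential_add hα hbt _
    rw [integral_sum_historyMeasure_succ π env t hg, Finset.sum_range_succ]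
    linarith

/-- Importance weighting is unbiased: arm `i` is explored with probability `p_i` and its loss is
then divided by `p_i`. -/
theorem integral_lossEst_le {α : ℝ} (hα : 1 < α) {η : ℕ → ℝ} (hη : ∀ t, 0 < η t)
    (R : RankRule K) (env : Environment K) (T : ℕ) (i : Fin K) :
    ∫ h, lossEst α η R T (observe h) i ∂historyMeasure (ftpl α hα η hη R) env T
      ≤ ∫ h, ∑ s, ((h s).1 i : ℝ) ∂historyMeasure (ftpl α hα η hη R) env T := by
  set π := ftpl α hα η hη R with hπ
  have hα0 : 0 < α := by linarith
  have := isProbabilityMeasure_pertMeasure hα0 K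
  induction T with
  | zero => simp [lossEst]
  | succ t ih =>
    have hl := bddMeasurable_loss (K := K) i
    have hL := fun t => bddMeasurable_lossEst α hα0 hη R t i
    rw [integral_sum_historyMeasure_succ π env t hl]
    refine le_trans ?_ (add_le_add_left ih _)
    rw [← integral_historyMeasure_init π env t (hL t), ← integral_add
      (((hL t).comp measurable_init).integrable _)
      ((hl.comp (measurable_pi_apply (Fin.last t))).integrable _)]
    refine integral_historyMeasure_succ_mono π env t (hL (t + 1))
      (((hL t).comp measurable_init).add (hl.comp (measurable_pi_apply (Fin.last t)))) fun h => ?_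
    refine integral_roundKernel_mono π env h
      ((hL (t + 1)).comp (measurable_snoc.comp measurable_prodMk_left))
      ((((hL t).comp measurable_init).add (hl.comp (measurable_pi_apply (Fin.last t)))).comp
        (measurable_snoc.comp measurable_prodMk_left)) fun ℓ => ?_
    simp only [hπ, integral_kernel_ftpl hα hη, lossEst_observe_snoc, Fin.init_snoc, Fin.snoc_last,
      Pi.add_apply]
    simp only [add_comm (lossEst α η R t (observe h) i), sum_exploreDist_mul_add hη,
      ← Finset.sum_mul, sum_exploreDist hη, one_mul]
    refine le_of_eq ?_
    congr 1
    funext r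
    congr 1
    rw [Finset.sum_eq_single i]
    · have hp : 0 < exploreDist α η R t (observe h) i := exploreProb_pos (hη t) _ _ _
      rw [Pi.single_eq_same]; field_simp
    · intro j _ hj
      simp [Pi.single_eq_of_ne (Ne.symm hj)]
    · simp

theorem antitone_learningRate (α : ℝ) {c : ℝ} (hc : 0 < c) (K : ℕ) :
    Antitone (learningRate α c K) := by
  intro s t hst
  have : (s : ℝ) ≤ t := by exact_mod_cast hst
  unfold learningRate
  gcongr

theorem pseudoRegret_ftpl_le {α : ℝ} (hα : 1 < α) {c : ℝ} (hc : 0 < c) (R : RankRule K)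
    (env : Environment K) (T : ℕ) :
    pseudoRegret (ftpl α hα (learningRate α c K) (learningRate_pos α hc K) R) env T
      ≤ ((1 + α / (α - 1)) / c + 6 * α * c * (2 * α / (α - 1)) ^ 2) * √((K : ℝ) * (T : ℝ)) := by
  have hα0 : 0 < α := by linarith
  have hK : (0 : ℝ) < K := by exact_mod_cast Nat.pos_of_neZero K
  set η := learningRate α c K with hηdef
  have hη : ∀ t, 0 < η t := learningRate_pos α hc K
  set π := ftpl α hα η hη R with hπ
  obtain ⟨i, hi⟩ := exists_eq_ciInf_of_finite
    (f := fun i : Fin K => ∫ h, ∑ s, ((h s).1 i : ℝ) ∂historyMeasure π env T)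
  -- The inverse rate of the last round when `0 < T`, and `0` when `T = 0`.
  set b : ℝ := √T * (K : ℝ) ^ (1 / 2 - 1 / α) / c with hbdef
  have hb0 : 0 ≤ b := by positivity
  have hb : ∀ s < T, (η s)⁻¹ ≤ b := by
    intro s hs
    have hs' : (s : ℝ) + 1 ≤ T := by exact_mod_cast hs
    have : (η s)⁻¹ = √((s : ℝ) + 1) * (K : ℝ) ^ (1 / 2 - 1 / α) / c := by
      rw [hηdef, learningRate, inv_div, ← neg_sub (1 / α), Real.rpow_neg hK.le]
      field_simp
    rw [this, hbdef]
    gcongr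
  have h1 := integral_exploitLoss_le hα hη (antitone_learningRate α hc K) R env T hb0 hb
  have h2 : ∫ h, potential α b (lossEst α η R T (observe h)) ∂historyMeasure π env T
      ≤ ∫ h, lossEst α η R T (observe h) i ∂historyMeasure π env T :=
    integral_mono ((bddMeasurable_potential hα hη R T hb0).integrable _)
      ((bddMeasurable_lossEst α hα0 hη R T i).integrable _) fun h => potential_le hα hb0 _ i
  have h3 := integral_lossEst_le hα hη R env T i
  have h4 : b * pertBound α K = (1 + α / (α - 1)) / c * √(K * T) := by
    rw [hbdef, pertBound, Real.sqrt_mul hK.le, Real.sqrt_eq_rpow (K : ℝ)]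
    have : (K : ℝ) ^ (1 / 2 - 1 / α) * (K : ℝ) ^ (1 / α) = (K : ℝ) ^ ((1 : ℝ) / 2) := by
      rw [← Real.rpow_add hK]; ring_nf
    rw [← this]
    ring
  have h5 : ∑ s ∈ Finset.range T, stabilityBound α (η s) K
      ≤ 6 * α * c * (2 * α / (α - 1)) ^ 2 * √(K * T) := by
    have h6 : ∀ s : ℕ, stabilityBound α (η s) K
        = 3 * α * c * (2 * α / (α - 1)) ^ 2 * √K * ((s : ℝ) + 1) ^ (-(1 / 2) : ℝ) := by
      intro s
      have e1 : (K : ℝ) ^ (1 / α - 1 / 2) * (K : ℝ) ^ (1 - 1 / α) = √K := by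
        rw [Real.sqrt_eq_rpow, ← Real.rpow_add hK]; ring_nf
      rw [stabilityBound, hηdef, learningRate, Real.rpow_neg (by positivity), ← Real.sqrt_eq_rpow,
        ← e1]
      ring
    simp only [h6, ← Finset.mul_sum]
    have h7 := sum_rpow_neg_le (s := 1 / 2) (by norm_num) (by norm_num) T
    have e2 : (T : ℝ) ^ ((1 : ℝ) - 1 / 2) / (1 - 1 / 2) = 2 * √T := by
      rw [Real.sqrt_eq_rpow]; norm_num; ring
    rw [e2] at h7
    refine (mul_le_mul_of_nonneg_left h7 (by positivity)).trans_eq ?_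
    rw [Real.sqrt_mul hK.le]; ring
  rw [pseudoRegret, ← hi, add_mul]
  linarith

end UpperBound

namespace BddMeasurable

variable {X : Type*} [MeasurableSpace X] {f g : X → ℝ}

theorem mul (hf : BddMeasurable f) (hg : BddMeasurable g) : BddMeasurable fun x => f x * g x := by
  obtain ⟨hf, C, hC⟩ := hf
  obtain ⟨hg, D, hD⟩ := hg
  refine ⟨hf.mul hg, C * D, fun x => ?_⟩
  rw [abs_mul]
  exact mul_le_mul (hC x) (hD x) (abs_nonneg _) ((abs_nonneg _).trans (hC x))

theorem prod {ι : Type*} (s : Finset ι) {F : ι → X → ℝ} (h : ∀ i ∈ s, BddMeasurable (F i)) :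
    BddMeasurable fun x => ∏ i ∈ s, F i x := by
  classical
  induction s using Finset.induction_on with
  | empty => simpa using const 1
  | insert i s hi ih =>
    simp only [Finset.prod_insert hi]
    exact (h i (by simp)).mul (ih fun k hk => h k (by simp [hk]))

theorem of_finite [Finite X] [MeasurableSingletonClass X] (f : X → ℝ) : BddMeasurable f := by
  obtain ⟨C, hC⟩ := (Set.finite_range fun x => |f x|).bddAbove
  exact ⟨measurable_of_countable f, C, fun x => hC ⟨x, rfl⟩⟩

end BddMeasurable

/-! ### Bernoulli environments and change of measure. -/

section LowerBound

variable {K : ℕ}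

/-- The Bernoulli law on losses, with mean `p`. -/
noncomputable def bernoulliLoss (p : ℝ) : Measure Loss :=
  ENNReal.ofReal (1 - p) • Measure.dirac 0 + ENNReal.ofReal p • Measure.dirac 1

theorem isProbabilityMeasure_bernoulliLoss {p : ℝ} (h0 : 0 ≤ p) (h1 : p ≤ 1) :
    IsProbabilityMeasure (bernoulliLoss p) := by
  refine ⟨?_⟩
  simp only [bernoulliLoss, Measure.add_apply, Measure.smul_apply, measure_univ, smul_eq_mul,
    mul_one]
  rw [← ENNReal.ofReal_add (by linarith) h0]
  simp

theorem integral_bernoulliLoss {p : ℝ} (h0 : 0 ≤ p) (h1 : p ≤ 1) (g : Loss → ℝ) :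
    ∫ y, g y ∂bernoulliLoss p = (1 - p) * g 0 + p * g 1 := by
  rw [bernoulliLoss, integral_add_measure
    ((integrable_dirac (by simp)).smul_measure ENNReal.ofReal_ne_top)
    ((integrable_dirac (by simp)).smul_measure ENNReal.ofReal_ne_top), integral_smul_measure,
    integral_smul_measure, integral_dirac, integral_dirac, ENNReal.toReal_ofReal (by linarith),
    ENNReal.toReal_ofReal h0, smul_eq_mul, smul_eq_mul]

/-- The law of a vector of independent Bernoulli losses with means `m`. -/
noncomputable def bernoulliLosses (m : Fin K → ℝ) (hm : ∀ i, m i ∈ Set.Icc (0 : ℝ) 1) :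
    ProbabilityMeasure (Fin K → Loss) :=
  ⟨Measure.pi fun i => bernoulliLoss (m i), by
    have := fun i => isProbabilityMeasure_bernoulliLoss (hm i).1 (hm i).2
    infer_instance⟩

variable {m : Fin K → ℝ} (hm : ∀ i, m i ∈ Set.Icc (0 : ℝ) 1)

theorem integral_bernoulliLosses (i : Fin K) {g : Loss → ℝ} (hg : Measurable g) :
    ∫ ℓ, g (ℓ i) ∂(bernoulliLosses m hm : Measure (Fin K → Loss))
      = (1 - m i) * g 0 + m i * g 1 := by
  have := fun i => isProbabilityMeasure_bernoulliLoss (hm i).1 (hm i).2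
  have h := measurePreserving_eval (fun i => bernoulliLoss (m i)) i
  rw [← integral_bernoulliLoss (hm i).1 (hm i).2, ← h.map_eq,
    integral_map h.measurable.aemeasurable hg.aestronglyMeasurable]
  rfl

/-- The map `φ` allows one statement for the exploited arm, the explored arm and a fixed arm: the
loss vector is independent of the arms, so the loss looked up is Bernoulli with mean `m (φ a)`. -/
theorem integral_roundKernel_bernoulli (π : Policy K) {t : ℕ} (h : Fin t → Round K)
    (φ : Fin K × Fin K → Fin K) {g : (Fin K × Fin K) × Loss → ℝ} (hg : BddMeasurable g) :
    ∫ x : Round K, g (x.2, x.1 (φ x.2))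
        ∂roundKernel π (Environment.iid (bernoulliLosses m hm)) t h
      = ∫ a, ((1 - m (φ a)) * g (a, 0) + m (φ a) * g (a, 1)) ∂π.kernel t (observe h) := by
  have hφ : Measurable fun x : Round K => (x.2, x.1 (φ x.2)) :=
    measurable_snd.prodMk (measurable_apply_fst
      ((measurable_of_countable φ).comp measurable_snd) measurable_fst)
  rw [roundKernel_apply, integral_prod_symm _ ((hg.comp hφ).integrable _)]
  refine integral_congr_ae (Filter.Eventually.of_forall fun a => ?_)
  exact integral_bernoulliLosses hm (φ a) (g := fun y => g (a, y))
    (hg.1.comp measurable_prodMk_left)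

theorem integral_sum_historyMeasure_congr (π : Policy K) (env : Environment K) (T : ℕ)
    {f g : Round K → ℝ} (hf : BddMeasurable f) (hg : BddMeasurable g)
    (hfg : ∀ t h, ∫ x, f x ∂roundKernel π env t h = ∫ x, g x ∂roundKernel π env t h) :
    ∫ h, ∑ s, f (h s) ∂historyMeasure π env T = ∫ h, ∑ s, g (h s) ∂historyMeasure π env T := by
  induction T with
  | zero => simp
  | succ t ih =>
    rw [integral_sum_historyMeasure_succ π env t hf, integral_sum_historyMeasure_succ π env t hg, ih,
      integral_historyMeasure_succ π env t (hf.comp (measurable_pi_apply (Fin.last t))),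
      integral_historyMeasure_succ π env t (hg.comp (measurable_pi_apply (Fin.last t)))]
    simp [hfg]

theorem bddMeasurable_obs_loss : BddMeasurable fun o : (Fin K × Fin K) × Loss => (o.2 : ℝ) :=
  BddMeasurable.of_mem_Icc (by fun_prop) fun o => o.2.2

theorem bddMeasurable_obs_arms (u : Fin K × Fin K → ℝ) :
    BddMeasurable fun o : (Fin K × Fin K) × Loss => u o.1 :=
  (BddMeasurable.of_finite u).comp measurable_fst

theorem bddMeasurable_round_arms (u : Fin K × Fin K → ℝ) :
    BddMeasurable fun x : Round K => u x.2 :=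
  (BddMeasurable.of_finite u).comp measurable_snd

theorem integral_sum_loss_bernoulli (π : Policy K) (T : ℕ) (φ : Fin K × Fin K → Fin K) :
    ∫ h, ∑ s, ((h s).1 (φ (h s).2) : ℝ)
        ∂historyMeasure π (Environment.iid (bernoulliLosses m hm)) T
      = ∫ h, ∑ s, m (φ (h s).2)
        ∂historyMeasure π (Environment.iid (bernoulliLosses m hm)) T := by
  have hφ : Measurable fun x : Round K => (x.2, x.1 (φ x.2)) :=
    measurable_snd.prodMk (measurable_apply_fst
      ((measurable_of_countable φ).comp measurable_snd) measurable_fst)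
  refine integral_sum_historyMeasure_congr π _ T (bddMeasurable_obs_loss.comp hφ)
    (bddMeasurable_round_arms fun a => m (φ a)) fun t h => ?_
  rw [integral_roundKernel_bernoulli hm π h φ bddMeasurable_obs_loss,
    integral_roundKernel_bernoulli hm π h φ (bddMeasurable_obs_arms fun a => m (φ a))]
  refine integral_congr_ae (Filter.Eventually.of_forall fun a => ?_)
  simp only [Set.Icc.coe_zero, Set.Icc.coe_one]
  ring

/-- The likelihood ratio of one observation, for Bernoulli losses with means `m` against fair
coins. -/
def likelihood (m : Fin K → ℝ) (o : Obs K) : ℝ :=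
  2 * (1 - m o.1.2) * (1 - (o.2 : ℝ)) + 2 * m o.1.2 * (o.2 : ℝ)

theorem bddMeasurable_likelihood (m : Fin K → ℝ) : BddMeasurable (likelihood m) := by
  have h1 := bddMeasurable_obs_arms fun a : Fin K × Fin K => 2 * (1 - m a.2)
  have h2 := bddMeasurable_obs_arms fun a : Fin K × Fin K => 2 * m a.2
  have h3 : BddMeasurable fun o : (Fin K × Fin K) × Loss => 1 - (o.2 : ℝ) :=
    BddMeasurable.of_mem_Icc (a := 0) (b := 1) (by fun_prop)
      fun o => ⟨by linarith [o.2.2.2], by linarith [o.2.2.1]⟩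
  exact (h1.mul h3).add (h2.mul bddMeasurable_obs_loss)

/-- `likelihood` is affine in the loss, hence a convex combination of `2 * (1 - m)` and `2 * m`. Its
logarithm is thus bounded for all losses in `[0, 1]`, not only for `0` and `1`. -/
theorem half_le_likelihood (hq : ∀ i, m i ∈ Set.Icc (1 / 4 : ℝ) (3 / 4)) (o : Obs K) :
    1 / 2 ≤ likelihood m o := by
  have h1 := hq o.1.2
  have h2 := o.2.2
  unfold likelihood
  nlinarith [h1.1, h1.2, h2.1, h2.2, mul_nonneg h2.1 (sub_nonneg.2 h1.1),
    mul_nonneg (sub_nonneg.2 h2.2) (sub_nonneg.2 h1.2)]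

theorem likelihood_le_two (o : Obs K) (h0 : ∀ i, m i ∈ Set.Icc (0 : ℝ) 1) :
    likelihood m o ≤ 2 := by
  have h1 := h0 o.1.2
  have h2 := o.2.2
  unfold likelihood
  nlinarith [h1.1, h1.2, h2.1, h2.2, mul_nonneg h2.1 (sub_nonneg.2 h1.2),
    mul_nonneg (sub_nonneg.2 h2.2) h1.1]

theorem bddMeasurable_log_likelihood (hq : ∀ i, m i ∈ Set.Icc (1 / 4 : ℝ) (3 / 4)) :
    BddMeasurable fun o : Obs K => Real.log (likelihood m o) := by
  refine BddMeasurable.of_mem_Icc (a := Real.log (1 / 2)) (b := Real.log 2)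
    (Real.measurable_log.comp (bddMeasurable_likelihood m).1) fun o => ⟨?_, ?_⟩
  · exact Real.log_le_log (by norm_num) (half_le_likelihood hq o)
  · exact Real.log_le_log (by linarith [half_le_likelihood hq o]) (likelihood_le_two o
      fun i => ⟨by linarith [(hq i).1], by linarith [(hq i).2]⟩)

/-- The means of fair coins. -/
noncomputable def fairMeans (K : ℕ) : Fin K → ℝ := fun _ => 1 / 2

theorem fairMeans_mem (i : Fin K) : fairMeans K i ∈ Set.Icc (0 : ℝ) 1 := by
  constructor <;> norm_num [fairMeans]

theorem integral_historyMeasure_bernoulli_succ (π : Policy K) (t : ℕ)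
    {f : (Fin (t + 1) → Obs K) → ℝ} (hf : BddMeasurable f) :
    ∫ h, f (observe h) ∂historyMeasure π (Environment.iid (bernoulliLosses m hm)) (t + 1)
      = ∫ h, ∫ a, ((1 - m a.2) * f (Fin.snoc (α := fun _ => Obs K) (observe h) (a, 0))
          + m a.2 * f (Fin.snoc (α := fun _ => Obs K) (observe h) (a, 1))) ∂π.kernel t (observe h)
        ∂historyMeasure π (Environment.iid (bernoulliLosses m hm)) t := by
  rw [integral_historyMeasure_succ π _ t (hf.comp measurable_observe)]
  refine integral_congr_ae (Filter.Eventually.of_forall fun h => ?_)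
  simp only [observe_snoc]
  have hs : Measurable fun o : Obs K =>
      (Fin.snoc (α := fun _ => Obs K) (observe h) o : Fin (t + 1) → Obs K) := by
    refine measurable_pi_lambda _ fun s => ?_
    refine Fin.lastCases ?_ (fun s => ?_) s
    · simpa only [Fin.snoc_last] using measurable_id'
    · simp
  exact integral_roundKernel_bernoulli hm π h Prod.snd (hf.comp hs)

theorem bddMeasurable_integral_kernel (π : Policy K) (t : ℕ)
    {f : (Fin t → Obs K) × (Fin K × Fin K) → ℝ} (hf : BddMeasurable f) :
    BddMeasurable fun o => ∫ a, f (o, a) ∂π.kernel t o := by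
  obtain ⟨hm, C, hC⟩ := hf
  refine ⟨(StronglyMeasurable.integral_kernel_prod_right' hm.stronglyMeasurable).measurable, C,
    fun o => ?_⟩
  refine (norm_integral_le_of_norm_le_const (f := fun a => f (o, a)) (C := C)
    (Filter.Eventually.of_forall fun a => hC (o, a))).trans_eq ?_
  simp

/-- The policy depends on the observations only, so its kernels are the same in both environments
and cancel; each round contributes just the ratio of the laws of the observed loss. -/
theorem integral_bernoulli_eq_integral_fair (π : Policy K) (T : ℕ)
    {f : (Fin T → Obs K) → ℝ} (hf : BddMeasurable f) :
    ∫ h, f (observe h) ∂historyMeasure π (Environment.iid (bernoulliLosses m hm)) T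
      = ∫ h, f (observe h) * ∏ s, likelihood m (observe h s)
        ∂historyMeasure π (Environment.iid (bernoulliLosses (fairMeans K) fairMeans_mem)) T := by
  induction T with
  | zero => simp [historyMeasure]
  | succ t ih =>
    have hprod : BddMeasurable fun o : Fin (t + 1) → Obs K => ∏ s, likelihood m (o s) :=
      BddMeasurable.prod _ fun s _ => (bddMeasurable_likelihood m).comp (measurable_pi_apply s)
    rw [integral_historyMeasure_bernoulli_succ hm π t hf,
      integral_historyMeasure_bernoulli_succ fairMeans_mem π t (hf.mul hprod)]
    have hs : ∀ y : Loss, Measurable fun x : (Fin t → Obs K) × (Fin K × Fin K) =>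
        (Fin.snoc (α := fun _ => Obs K) x.1 (x.2, y) : Fin (t + 1) → Obs K) := by
      intro y
      refine measurable_pi_lambda _ fun s => ?_
      refine Fin.lastCases ?_ (fun s => ?_) s
      · simpa using measurable_snd.prodMk measurable_const
      · simpa [Function.comp_def] using (measurable_pi_apply s).comp measurable_fst
    have hu : ∀ u : Fin K → ℝ, BddMeasurable fun x : (Fin t → Obs K) × (Fin K × Fin K) => u x.2.2 :=
      fun u => (BddMeasurable.of_finite u).comp (measurable_snd.comp measurable_snd)
    have hG := bddMeasurable_integral_kernel π t
      (((hu fun j => 1 - m j).mul (hf.comp (hs 0))).add ((hu m).mul (hf.comp (hs 1))))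
    -- The induction hypothesis is applied to the function obtained by integrating out the last
    -- round.
    rw [ih hG]
    refine integral_congr_ae (Filter.Eventually.of_forall fun h => ?_)
    simp only
    rw [← integral_mul_const]
    refine integral_congr_ae (Filter.Eventually.of_forall fun a => ?_)
    simp only [Fin.prod_univ_castSucc, Fin.snoc_castSucc, Fin.snoc_last, likelihood, fairMeans,
      Set.Icc.coe_zero, Set.Icc.coe_one]
    ring

/-- The expected logarithmic likelihood ratio is controlled by the number of explorations of the
arms whose mean differs from that of a fair coin. -/
theorem integral_sum_log_likelihood_fair (hq : ∀ i, m i ∈ Set.Icc (1 / 4 : ℝ) (3 / 4))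
    (π : Policy K) (T : ℕ) :
    ∫ h, ∑ s, Real.log (likelihood m (observe h s))
        ∂historyMeasure π (Environment.iid (bernoulliLosses (fairMeans K) fairMeans_mem)) T
      = ∫ h, ∑ s, Real.log (4 * m (h s).2.2 * (1 - m (h s).2.2)) / 2
        ∂historyMeasure π (Environment.iid (bernoulliLosses (fairMeans K) fairMeans_mem)) T := by
  have hlog := bddMeasurable_log_likelihood hq
  have hobs : Measurable fun x : Round K => ((x.2, x.1 x.2.2) : Obs K) :=
    measurable_snd.prodMk (measurable_apply_fst (measurable_snd.comp measurable_snd) measurable_fst)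
  refine integral_sum_historyMeasure_congr π _ T (hlog.comp hobs)
    (bddMeasurable_round_arms fun a => Real.log (4 * m a.2 * (1 - m a.2)) / 2) fun t h => ?_
  rw [integral_roundKernel_bernoulli fairMeans_mem π h Prod.snd hlog,
    integral_roundKernel_bernoulli fairMeans_mem π h Prod.snd
      (bddMeasurable_obs_arms fun a => Real.log (4 * m a.2 * (1 - m a.2)) / 2)]
  refine integral_congr_ae (Filter.Eventually.of_forall fun a => ?_)
  have h1 := hq a.2
  have h2 : 4 * m a.2 * (1 - m a.2) = (2 * (1 - m a.2)) * (2 * m a.2) := by ring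
  simp only [likelihood, fairMeans, Set.Icc.coe_zero, Set.Icc.coe_one]
  rw [h2, Real.log_mul (by linarith [h1.2]) (by linarith [h1.1])]
  ring_nf

/-- A pointwise substitute for Pinsker's inequality. With `s = √Z`, Young's inequality splits `Z - 1
= (s - 1) * (s + 1)`; then `(s - 1) ^ 2 ≤ Z - 1 - log Z`, as for the Hellinger distance, and `(s +
1) ^ 2 ≤ 2 * (Z + 1)`. For a likelihood ratio `Z` of mean `1`, integration gives `2 / l` plus `l /
2` times the divergence. -/
theorem sub_one_le_of_pos {Z l : ℝ} (hZ : 0 < Z) (hl : 0 < l) :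
    Z - 1 ≤ l / 2 * (Z - 1 - Real.log Z) + (Z + 1) / l := by
  set s := √Z with hs
  have hs0 : 0 < s := Real.sqrt_pos.2 hZ
  have hs2 : Z = s ^ 2 := (Real.sq_sqrt hZ.le).symm
  have hlog : Real.log Z ≤ 2 * (s - 1) := by
    rw [hs2, Real.log_pow]
    have := Real.log_le_sub_one_of_pos hs0
    push_cast
    linarith
  have h1 : l / 2 * (s - 1) ^ 2 ≤ l / 2 * (Z - 1 - Real.log Z) :=
    mul_le_mul_of_nonneg_left (by nlinarith) (by positivity)
  have h2 : (s + 1) ^ 2 / (2 * l) ≤ (Z + 1) / l := by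
    rw [div_le_div_iff₀ (by positivity) hl, hs2]
    nlinarith [mul_nonneg hl.le (sq_nonneg (s - 1))]
  have h3 : 0 ≤ (l * (s - 1) - (s + 1)) ^ 2 / (2 * l) := by positivity
  have h4 : (l * (s - 1) - (s + 1)) ^ 2 / (2 * l)
      = l / 2 * (s - 1) ^ 2 + (s + 1) ^ 2 / (2 * l) - (s ^ 2 - 1) := by
    field_simp
    ring
  rw [hs2] at h1 h2 ⊢
  linarith

/-- Comparison of expectations under two Bernoulli environments through the likelihood ratio of the
observed history. -/
theorem integral_bernoulli_le_integral_fair (hq : ∀ i, m i ∈ Set.Icc (1 / 4 : ℝ) (3 / 4))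
    (π : Policy K) (T : ℕ) {f : (Fin T → Obs K) → ℝ} (hf : BddMeasurable f) {N l : ℝ} (hl : 0 < l)
    (h0 : ∀ o, 0 ≤ f o) (hN : ∀ o, f o ≤ N) :
    ∫ h, f (observe h) ∂historyMeasure π (Environment.iid (bernoulliLosses m hm)) T
      ≤ ∫ h, f (observe h)
          ∂historyMeasure π (Environment.iid (bernoulliLosses (fairMeans K) fairMeans_mem)) T
        + N * (2 / l - l / 2 * ∫ h, ∑ s, Real.log (4 * m (h s).2.2 * (1 - m (h s).2.2)) / 2
          ∂historyMeasure π
            (Environment.iid (bernoulliLosses (fairMeans K) fairMeans_mem)) T) := by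
  have hZ1 := integral_bernoulli_eq_integral_fair hm π T (BddMeasurable.const 1)
  rw [integral_bernoulli_eq_integral_fair hm π T hf, ← integral_sum_log_likelihood_fair hq]
  set P := historyMeasure π (Environment.iid (bernoulliLosses (fairMeans K) fairMeans_mem)) T
  have hlog := bddMeasurable_log_likelihood hq
  have hZ : BddMeasurable fun h : Fin T → Round K => ∏ s, likelihood m (observe h s) :=
    (BddMeasurable.prod (F := fun s (o : Fin T → Obs K) => likelihood m (o s)) Finset.univ
      fun s _ => (bddMeasurable_likelihood m).comp (measurable_pi_apply s)).comp measurable_observe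
  have hS : BddMeasurable fun h : Fin T → Round K => ∑ s, Real.log (likelihood m (observe h s)) :=
    (BddMeasurable.sum (F := fun s (o : Fin T → Obs K) => Real.log (likelihood m (o s))) Finset.univ
      fun s _ => hlog.comp (measurable_pi_apply s)).comp measurable_observe
  have hfo := hf.comp (measurable_observe (K := K) (t := T))
  have hpt : ∀ h : Fin T → Round K, f (observe h) * ∏ s, likelihood m (observe h s)
      ≤ f (observe h) + N * ((l / 2 + 1 / l) * (∏ s, likelihood m (observe h s))
        + ((1 / l - l / 2) + (-(l / 2)) * ∑ s, Real.log (likelihood m (observe h s)))) := by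
    intro h
    have hpos : ∀ s, 0 < likelihood m (observe h s) := fun s => by
      linarith [half_le_likelihood hq (observe h s)]
    rw [← Real.log_prod fun s _ => (hpos s).ne']
    set Z := ∏ s, likelihood m (observe h s)
    have hZ0 : 0 < Z := Finset.prod_pos fun s _ => hpos s
    have h1 := sub_one_le_of_pos hZ0 hl
    -- Nonnegativity of this bound allows the factor `f` to be replaced by `N`, even where `Z < 1`.
    have h2 : 0 ≤ l / 2 * (Z - 1 - Real.log Z) + (Z + 1) / l := by
      have := Real.log_le_sub_one_of_pos hZ0
      have : 0 ≤ Z - 1 - Real.log Z := by linarith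
      positivity
    have h3 : f (observe h) * (Z - 1) ≤ N * (l / 2 * (Z - 1 - Real.log Z) + (Z + 1) / l) :=
      (mul_le_mul_of_nonneg_left h1 (h0 _)).trans (mul_le_mul_of_nonneg_right (hN _) h2)
    have h4 : l / 2 * (Z - 1 - Real.log Z) + (Z + 1) / l
        = (l / 2 + 1 / l) * Z + ((1 / l - l / 2) + -(l / 2) * Real.log Z) := by
      ring
    rw [h4] at h3
    linarith
  have hA := (BddMeasurable.const (X := Fin T → Round K) (l / 2 + 1 / l)).mul hZ
  have hB := (BddMeasurable.const (X := Fin T → Round K) (-(l / 2))).mul hS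
  have hC := (BddMeasurable.const (X := Fin T → Round K) (1 / l - l / 2)).add hB
  have h5 := integral_mono ((hfo.mul hZ).integrable P)
    ((hfo.add ((BddMeasurable.const N).mul (hA.add hC))).integrable P) hpt
  rw [integral_add (hfo.integrable P) (((BddMeasurable.const N).mul (hA.add hC)).integrable P),
    integral_const_mul, integral_add (hA.integrable P) (hC.integrable P),
    integral_add ((BddMeasurable.const _).integrable P) (hB.integrable P), integral_const_mul,
    integral_const_mul] at h5
  have hZ1 : ∫ h, ∏ s, likelihood m (observe h s) ∂P = 1 := by simpa using hZ1.symm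
  rw [hZ1] at h5
  simp only [integral_const, probReal_univ, smul_eq_mul, one_mul] at h5
  refine h5.trans_eq ?_
  ring

end LowerBound

/-! ### Choice of the hard environment. -/

section LowerBound

variable {K : ℕ}

theorem sum_integral_count {T : ℕ} (μ : Measure (Fin T → Round K)) [IsProbabilityMeasure μ]
    (φ : Fin K × Fin K → Fin K) :
    ∑ a, ∫ h, ∑ s, (if φ (h s).2 = a then (1 : ℝ) else 0) ∂μ = T := by
  rw [← integral_finsetSum]
  · simp_rw [Finset.sum_comm (s := Finset.univ (α := Fin K))]
    simp
  · exact fun a _ => (BddMeasurable.sum _ fun s _ => (bddMeasurable_round_arms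
      fun x => if φ x = a then (1 : ℝ) else 0).comp (measurable_pi_apply s)).integrable μ

theorem neg_le_log_one_sub {u : ℝ} (h0 : 0 ≤ u) (h1 : u ≤ 1 / 2) : -(2 * u) ≤ Real.log (1 - u) := by
  have h2 : 0 < 1 - u := by linarith
  have h3 := Real.one_sub_inv_le_log_of_pos h2
  have h4 : (1 - u)⁻¹ ≤ 1 + 2 * u := by
    rw [inv_eq_one_div, div_le_iff₀ h2]
    nlinarith
  linarith

/-- For every policy there is an environment with i.i.d. Bernoulli losses in which its regret is at
least of the order of `√(K T)`. -/
theorem exists_le_pseudoRegret {T : ℕ} (hK : 2 ≤ K) (hKT : K ≤ T) (π : Policy K) :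
    ∃ ν : ProbabilityMeasure (Fin K → Loss),
      1 / 64 * √((K : ℝ) * (T : ℝ)) ≤ pseudoRegret π (Environment.iid ν) T := by
  have hK2 : (2 : ℝ) ≤ K := by exact_mod_cast hK
  have hKT' : (K : ℝ) ≤ T := by exact_mod_cast hKT
  have hK0 : (0 : ℝ) < K := by linarith
  have hT0 : (0 : ℝ) < T := by linarith
  have : NeZero K := ⟨by omega⟩
  -- Since `K ≤ T` the means stay within `[1/4, 3/4]`. The factor `16` makes `T * ε ^ 2 = K / 256`,
  -- so that `T / K` explorations of an arm reveal only a constant amount of information.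
  set ε : ℝ := √((K : ℝ) / T) / 16 with hε
  have hε0 : 0 ≤ ε := by positivity
  have hε1 : ε ≤ 1 / 16 := by
    have : √((K : ℝ) / T) ≤ 1 := Real.sqrt_le_one.2 ((div_le_one hT0).2 hKT')
    linarith
  have hε2 : T * ε ^ 2 = K / 256 := by
    rw [hε, div_pow, Real.sq_sqrt (by positivity)]; field_simp; norm_num
  set m : Fin K → Fin K → ℝ := fun a i => if i = a then 1 / 2 - ε else 1 / 2 with hmdef
  have hq : ∀ a i, m a i ∈ Set.Icc (1 / 4 : ℝ) (3 / 4) := by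
    intro a i
    simp only [hmdef]
    split_ifs <;> constructor <;> linarith
  have hm : ∀ a i, m a i ∈ Set.Icc (0 : ℝ) 1 := fun a i =>
    ⟨by linarith [(hq a i).1], by linarith [(hq a i).2]⟩
  set P₀ := historyMeasure π (Environment.iid (bernoulliLosses (fairMeans K) fairMeans_mem)) T
  set P : Fin K → Measure (Fin T → Round K) := fun a =>
    historyMeasure π (Environment.iid (bernoulliLosses (m a) (hm a))) T with hP
  have hPp : ∀ a, IsProbabilityMeasure (P a) := fun a =>
    isProbabilityMeasure_historyMeasure _ _ _
  set A : Fin K → ℝ := fun a => ∫ h, ∑ s, (if (h s).2.1 = a then (1 : ℝ) else 0) ∂P₀ with hA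
  set B : Fin K → ℝ := fun a => ∫ h, ∑ s, (if (h s).2.2 = a then (1 : ℝ) else 0) ∂P₀ with hB
  set N : Fin K → ℝ := fun a => ∫ h, ∑ s, (if (h s).2.1 = a then (1 : ℝ) else 0) ∂P a with hN
  have hbdd : ∀ (u : Fin K × Fin K → ℝ), BddMeasurable fun h : Fin T → Round K => ∑ s, u (h s).2 :=
    fun u => BddMeasurable.sum _ fun s _ => (bddMeasurable_round_arms u).comp (measurable_pi_apply s)
  have hsumA : ∑ a, A a = T := sum_integral_count P₀ Prod.fst
  have hsumB : ∑ a, B a = T := sum_integral_count P₀ Prod.snd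
  have hNle : ∀ a, N a ≤ A a + (T / 8 + K / 8 * B a) := by
    intro a
    -- With `l = 16` the error is `T / 8` plus `T * 8` times the divergence; the latter is at most
    -- `4 * ε ^ 2 * B a`, because only explorations of `a` are informative.
    have h1 := integral_bernoulli_le_integral_fair (hm a) (hq a) π T
      (f := fun o => ∑ s, (if (o s).1.1 = a then (1 : ℝ) else 0)) (N := T) (l := 16)
      (BddMeasurable.sum _ fun s _ => (bddMeasurable_obs_arms
        fun x => if x.1 = a then (1 : ℝ) else 0).comp (measurable_pi_apply s)) (by norm_num)
      (fun o => Finset.sum_nonneg fun s _ => by split_ifs <;> norm_num)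
      (fun o => (Finset.sum_le_sum (g := fun _ => (1 : ℝ)) fun s _ => by
        split_ifs <;> norm_num).trans (by simp))
    have h2 : -(4 * ε ^ 2) * B a
        ≤ ∫ h, ∑ s, Real.log (4 * m a (h s).2.2 * (1 - m a (h s).2.2)) / 2 ∂P₀ := by
      rw [hB, ← integral_const_mul]
      refine integral_mono (((BddMeasurable.const _).mul
        (hbdd fun x => if x.2 = a then (1 : ℝ) else 0)).integrable P₀)
        ((hbdd fun x => Real.log (4 * m a x.2 * (1 - m a x.2)) / 2).integrable P₀) fun h => ?_
      simp only [Finset.mul_sum]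
      refine Finset.sum_le_sum fun s _ => ?_
      by_cases hs : (h s).2.2 = a
      · have h3 := neg_le_log_one_sub (u := 4 * ε ^ 2) (by positivity) (by nlinarith)
        have h4 : 4 * (1 / 2 - ε) * (1 - (1 / 2 - ε)) = 1 - 4 * ε ^ 2 := by ring
        simp only [hmdef, hs, if_true, h4]
        linarith
      · simp [hmdef, hs]
        norm_num
    refine h1.trans (add_le_add_right ?_ _)
    have h5 : (T : ℝ) * (2 / 16 - 16 / 2 * (-(4 * ε ^ 2) * B a)) = T / 8 + K / 8 * B a := by
      linear_combination (32 * B a) * hε2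
    rw [← h5]
    gcongr
  -- Summing over the arms gives at most `T + K * T / 4`, and `2 ≤ K` makes this at most `3 / 4 * K
  -- * T`.
  obtain ⟨a, -, ha⟩ : ∃ a ∈ (Finset.univ : Finset (Fin K)), N a ≤ 3 / 4 * T := by
    refine Finset.exists_le_of_sum_le Finset.univ_nonempty ?_
    refine (Finset.sum_le_sum fun a _ => hNle a).trans ?_
    rw [Finset.sum_add_distrib, Finset.sum_add_distrib, ← Finset.mul_sum, hsumA, hsumB]
    simp only [Finset.sum_const, Finset.card_univ, Fintype.card_fin, nsmul_eq_mul]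
    nlinarith
  refine ⟨bernoulliLosses (m a) (hm a), ?_⟩
  have h1 : ∫ h, ∑ s, ((h s).1 (h s).2.1 : ℝ) ∂P a = T / 2 - ε * N a := by
    rw [hP, integral_sum_loss_bernoulli (hm a) π T Prod.fst, hN, ← integral_const_mul]
    have h2 : ∀ h : Fin T → Round K, ∑ s, m a (h s).2.1
        = T / 2 + (-ε) * ∑ s, (if (h s).2.1 = a then (1 : ℝ) else 0) := by
      intro h
      have : ∀ s, m a (h s).2.1 = 1 / 2 + (-ε) * (if (h s).2.1 = a then (1 : ℝ) else 0) := by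
        intro s
        simp only [hmdef]
        split_ifs <;> ring
      simp only [this, Finset.sum_add_distrib, ← Finset.mul_sum]
      simp [div_eq_mul_inv]
    simp only [h2]
    rw [integral_add (integrable_const _) (((BddMeasurable.const _).mul
      (hbdd fun x => if x.1 = a then (1 : ℝ) else 0)).integrable (P a)), integral_const_mul,
      integral_const_mul]
    simp
    ring
  have h2 : ∫ h, ∑ s, ((h s).1 a : ℝ) ∂P a = T * (1 / 2 - ε) := by
    rw [hP, integral_sum_loss_bernoulli (hm a) π T fun _ => a]
    simp [hmdef]
    ring
  have h3 := ciInf_le (Set.finite_range fun i : Fin K => ∫ h, ∑ s, ((h s).1 i : ℝ) ∂P a).bddBelow a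
  have h4 : 1 / 64 * √((K : ℝ) * T) = ε * T / 4 := by
    have : (K : ℝ) * T = K / T * T ^ 2 := by field_simp
    rw [this, Real.sqrt_mul (by positivity), Real.sqrt_sq hT0.le, hε]
    ring
  have h5 := mul_le_mul_of_nonneg_left ha hε0
  rw [h4]
  change _ ≤ (∫ h, ∑ s, ((h s).1 (h s).2.1 : ℝ) ∂P a) - ⨅ i, ∫ h, ∑ s, ((h s).1 i : ℝ) ∂P a
  rw [h1]
  simp only [h2] at h3
  linarith

end LowerBound

end DecoupledBandit

theorem theorem1 :
    (∀ (α : ℝ) (hα : 1 < α) (c : ℝ) (hc : 0 < c), ∃ C : ℝ,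
      ∀ (K : ℕ) [NeZero K] (R : DecoupledBandit.RankRule K)
        (env : DecoupledBandit.Environment K) (T : ℕ),
        DecoupledBandit.pseudoRegret
            (DecoupledBandit.ftpl α hα (DecoupledBandit.learningRate α c K)
              (DecoupledBandit.learningRate_pos α hc K) R) env T
          ≤ C * √((K : ℝ) * (T : ℝ))) ∧
    (∃ c₀ : ℝ, 0 < c₀ ∧
      ∀ (K T : ℕ), 2 ≤ K → K ≤ T → ∀ π : DecoupledBandit.Policy K,
        ∃ ν : MeasureTheory.ProbabilityMeasure (Fin K → DecoupledBandit.Loss),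
          c₀ * √((K : ℝ) * (T : ℝ))
            ≤ DecoupledBandit.pseudoRegret π (DecoupledBandit.Environment.iid ν) T) := by
  refine ⟨fun α hα c hc => ⟨_, fun K _ R env T => DecoupledBandit.pseudoRegret_ftpl_le hα hc R env T⟩,
    1 / 64, by norm_num, fun K T hK hKT π => DecoupledBandit.exists_le_pseudoRegret hK hKT π⟩
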